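/- Let $\Gamma$ be a metrized graph: a finite connected graph (multiple edges and self-loops allowed) with vertex set $V(\Gamma)$ and edge set $E(\Gamma)$, each edge $e_i$ being identified with a closed segment of positive length $L_i$, the end points glued at the vertices. Write $v=\#V(\Gamma)$, $e=\#E(\Gamma)$, $g=e-v+1$ for the genus (first Betti number), and $\ell(\Gamma)=\sum_i L_i$ for the total length. For points $y,z\in\Gamma$ let $x\mapsto j_z(x,y)$ be the voltage function, i.e. the continuous piecewise affine function on $\Gamma$ with $j_z(z,y)=0$ and $\Delta_x j_z(x,y)=\delta_y-\delta_z$, where $\Delta f=-\sum_{p}\big(\sum_{\vec v\text{ at }p}d_{\vec v}f(p)\big)\delta_p$ for continuous piecewise affine $f$ ($\vec v$ running over the directions emanating from $p$). Let $\mu_{can}$ be the canonical measure, i.e. the signed Borel measure $\mu$ on $\Gamma$ with $\mu(\Gamma)=1$ for which $j_\mu(x,x)$ does not depend on $x\in\Gamma$, where $j_\mu(x,y)=\int_\Gamma j_\zeta(x,y)\,d\mu(\zeta)$. The tau constant is $\tau(\Gamma)=\frac12 j_{\mu_{can}}(x,x)$. **Theorem.** Suppose that all edges of $\Gamma$ have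 the same length. 1. If $\ell(\Gamma)=1$ (so that every edge has length $\frac1e$), then $\tau(\Gamma)\ge\frac1{12}\left(\frac ge\right)^2$. 2. If $\ell(\Gamma)=1$, then moreover $\tau(\Gamma)\ge\frac1{12}\left(\frac ge\right)^2+\frac1{2v}\left(\frac{v-1}e\right)^2$. 3. If every vertex of $\Gamma$ has valence at least $3$ (a self-loop counting twice), then $\tau(\Gamma)\ge\frac1{108}\,\ell(\Gamma)$; that is, the lower bound conjecture of Baker and Rumely, which asserts that there is a universal constant $C>0$ with $\tau(\Gamma)\ge C\,\ell(\Gamma)$ for all metrized graphs $\Gamma$, holds for these graphs with $C=\frac1{108}$. -/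

import Mathlib

open MeasureTheory Set

/-- A metrized graph with vertex set `V` and edge set `E` (both taken finite below): a connected
graph, with multiple edges and self-loops allowed, each edge `e` being parametrized by a segment
`[0, length e]` of positive length running from `source e` to `target e`. -/
structure MetrizedGraph (V E : Type*) where
  source : E → V
  target : E → V
  length : E → ℝ
  length_pos : ∀ e, 0 < length e
  connected : (SimpleGraph.fromRel fun p q => ∃ e, source e = p ∧ target e = q).Connected

namespace MetrizedGraph

variable {V E : Type*}

/-- The points of the metrized graph: its vertices, and the interior points of its edges. -/
inductive Point (Γ : MetrizedGraph V E)
  | vertex (p : V) : Point Γ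
  | inner (e : E) (t : ℝ) (ht : t ∈ Ioo 0 (Γ.length e)) : Point Γ

instance (Γ : MetrizedGraph V E) : Nonempty Γ.Point :=
  Γ.connected.nonempty.map Point.vertex

/-- The parametrization `[0, length e] → Γ` of the edge `e` (extended to `ℝ` by constants). -/
noncomputable def pt (Γ : MetrizedGraph V E) (e : E) (t : ℝ) : Γ.Point :=
  if h₀ : t ≤ 0 then Point.vertex (Γ.source e)
  else if h₁ : Γ.length e ≤ t then Point.vertex (Γ.target e)
  else Point.inner e t ⟨not_le.mp h₀, not_le.mp h₁⟩

/-- The topology of `Γ`: the closed segments `[0, length e]` glued at their end points, i.e. the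
finest topology that makes the parametrizations of all edges continuous. -/
noncomputable instance (Γ : MetrizedGraph V E) : TopologicalSpace Γ.Point :=
  ⨆ e : E, TopologicalSpace.coinduced (fun t : Icc (0 : ℝ) (Γ.length e) => Γ.pt e t) inferInstance

noncomputable instance (Γ : MetrizedGraph V E) : MeasurableSpace Γ.Point := borel _

instance (Γ : MetrizedGraph V E) : BorelSpace Γ.Point := ⟨rfl⟩

/-- The total length of `Γ`. -/
def totalLength [Fintype E] (Γ : MetrizedGraph V E) : ℝ := ∑ e, Γ.length e

/-- The genus (first Betti number) `e - v + 1` of the connected graph `Γ`. -/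
def genus [Fintype V] [Fintype E] (_Γ : MetrizedGraph V E) : ℤ :=
  (Fintype.card E : ℤ) - (Fintype.card V : ℤ) + 1

open Classical in
/-- The valence of a vertex: the number of directions emanating from it. A self-loop counts
twice. -/
noncomputable def valence [Fintype E] (Γ : MetrizedGraph V E) (p : V) : ℕ :=
  (Finset.univ.filter fun e => Γ.source e = p).card +
    (Finset.univ.filter fun e => Γ.target e = p).card

/-- `f` is piecewise affine: there is a finite set of points such that `f` is affine along every
open segment of an edge that avoids it. -/
def IsPiecewiseAffine (Γ : MetrizedGraph V E) (f : Γ.Point → ℝ) : Prop :=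
  ∃ S : Set Γ.Point, S.Finite ∧ ∀ (e : E) (a b : ℝ), 0 ≤ a → b ≤ Γ.length e →
    (∀ t ∈ Ioo a b, Γ.pt e t ∉ S) → ∃ c d : ℝ, ∀ t ∈ Ioo a b, f (Γ.pt e t) = c * t + d

/-- Derivative of `f` at the point `t` of the edge `e`, in the forward direction. -/
noncomputable def forwardDeriv (Γ : MetrizedGraph V E) (f : Γ.Point → ℝ) (e : E) (t : ℝ) : ℝ :=
  derivWithin (fun s => f (Γ.pt e s)) (Ici t) t

/-- Derivative of `f` at the point `t` of the edge `e`, in the backward direction. -/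
noncomputable def backwardDeriv (Γ : MetrizedGraph V E) (f : Γ.Point → ℝ) (e : E) (t : ℝ) : ℝ :=
  -derivWithin (fun s => f (Γ.pt e s)) (Iic t) t

open Classical in
/-- The sum of the directional derivatives of `f` at a point, over all directions emanating from
that point. For a continuous piecewise affine `f`, the measure-valued Laplacian `Δ f` is
`- ∑ p, slopeSum f p • δ_p`. -/
noncomputable def slopeSum [Fintype E] (Γ : MetrizedGraph V E) (f : Γ.Point → ℝ) : Γ.Point → ℝ
  | Point.vertex p =>
      (∑ e with Γ.source e = p, Γ.forwardDeriv f e 0) +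
        ∑ e with Γ.target e = p, Γ.backwardDeriv f e (Γ.length e)
  | Point.inner e t _ => Γ.forwardDeriv f e t + Γ.backwardDeriv f e t

open Classical in
/-- `f` is the voltage (with reference voltage `0` at `z`) when unit current enters at `y` and
exits at `z`: it is continuous, piecewise affine, vanishes at `z`, and `Δ f = δ_y - δ_z`. -/
def IsVoltage [Fintype E] (Γ : MetrizedGraph V E) (z y : Γ.Point) (f : Γ.Point → ℝ) : Prop :=
  Continuous f ∧ Γ.IsPiecewiseAffine f ∧ f z = 0 ∧
    ∀ p, -Γ.slopeSum f p = (if p = y then 1 else 0) - (if p = z then 1 else 0)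

/-- The voltage function `j_z(x, y)` on `Γ`: as a function of `x`, the function that satisfies
`IsVoltage z y`. -/
noncomputable def voltage [Fintype E] (Γ : MetrizedGraph V E) (z x y : Γ.Point) : ℝ :=
  Classical.epsilon (Γ.IsVoltage z y) x

/-- `j_μ(x, y) = ∫ j_ζ(x, y) dμ(ζ)` for a signed Borel measure `μ` on `Γ` (finiteness of the
total variation is automatic, signed measures being real-valued). -/
noncomputable def measureVoltage [Fintype E] (Γ : MetrizedGraph V E) (μ : SignedMeasure Γ.Point)
    (x y : Γ.Point) : ℝ :=
  ∫ᵛ ζ, Γ.voltage ζ x y ∂•μ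

/-- `μ` has total mass one and `j_μ(x, x)` is constant on `Γ`. -/
def IsCanonicalMeasure [Fintype E] (Γ : MetrizedGraph V E) (μ : SignedMeasure Γ.Point) : Prop :=
  μ univ = 1 ∧ ∀ x y, Γ.measureVoltage μ x x = Γ.measureVoltage μ y y

/-- The canonical measure of `Γ`. -/
noncomputable def canonicalMeasure [Fintype E] (Γ : MetrizedGraph V E) : SignedMeasure Γ.Point :=
  Classical.epsilon Γ.IsCanonicalMeasure

/-- The tau constant of `Γ`: half of the constant value of `j_μ(x, x)`, where `μ` is the canonical
measure. -/
noncomputable def tau [Fintype E] (Γ : MetrizedGraph V E) : ℝ :=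
  let x : Γ.Point := Classical.arbitrary _
  1 / 2 * Γ.measureVoltage Γ.canonicalMeasure x x

end MetrizedGraph

/-! Let G be a Green function of the vertex Laplacian, r(p,q) = G(p,p) - 2G(p,q) + G(q,q) the
effective resistance, R_e the resistance between the ends of e, and F_e = 1 - R_e/L_e. Interpolating
G along the edges and adding the Dirichlet Green function of each edge gives a Green function on Γ,
whence j_z(x,x) = r(x,z) (`voltage_self`). The measure Σ_p δ_p + Σ_e (F_e/L_e dt minus half a point
mass at each end) makes the integral of r(x,z) over z independent of x (`canonInt_resPt`). For any
other canonical measure, integrating r against both measures in either order yields the same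
constant, so uniqueness of the canonical measure is not needed
(`IsCanonicalMeasure.measureVoltage_eq`).

Evaluating the constant gives, for every vertex y, τ = (1/12) Σ L_e F_e² + (1/4) energy of r(·,y)
(`tau_eq_energy`). Foster's theorem says Σ R_e/L_e = v - 1, that is Σ F_e = g, so for equal lengths
Cauchy-Schwarz bounds the first term below by ℓ(g/e)²/12. Averaging the energy over y and keeping,
for each edge, only the y at its ends leaves (1/2v) Σ R_e²/L_e, and Cauchy-Schwarz applies again.
Valence at least 3 forces 3v ≤ 2e, so g/e ≥ 1/3 and 1/12 · 1/9 = 1/108. -/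

namespace MetrizedGraph

variable {V E : Type*}

/-! ### Dirichlet energy and Green function on the vertices. -/

/-- The Dirichlet energy pairing of two functions on the vertices. -/
noncomputable def energy [Fintype E] (Γ : MetrizedGraph V E) (f h : V → ℝ) : ℝ :=
  ∑ e, (f (Γ.source e) - f (Γ.target e)) * (h (Γ.source e) - h (Γ.target e)) / Γ.length e

theorem energy_comm [Fintype E] (Γ : MetrizedGraph V E) (f h : V → ℝ) :
    Γ.energy f h = Γ.energy h f :=
  Finset.sum_congr rfl fun _ _ => by ring

/-- A function on the vertices that agrees at the end points of every edge is constant. -/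
theorem eq_of_forall_edge_eq (Γ : MetrizedGraph V E) {f : V → ℝ}
    (h : ∀ e, f (Γ.source e) = f (Γ.target e)) (p q : V) : f p = f q := by
  obtain ⟨w⟩ := Γ.connected.preconnected p q
  induction w with
  | nil => rfl
  | cons hadj _ ih =>
    refine Eq.trans ?_ ih
    rw [SimpleGraph.fromRel_adj] at hadj
    rcases hadj.2 with ⟨e, rfl, rfl⟩ | ⟨e, rfl, rfl⟩
    · exact h e
    · exact (h e).symm

theorem energy_self_nonneg [Fintype E] (Γ : MetrizedGraph V E) (f : V → ℝ) :
    0 ≤ Γ.energy f f :=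
  Finset.sum_nonneg fun e _ => div_nonneg (mul_self_nonneg _) (Γ.length_pos e).le

theorem eq_of_energy_self_eq_zero [Fintype E] (Γ : MetrizedGraph V E) {f : V → ℝ}
    (h : Γ.energy f f = 0) (p q : V) : f p = f q := by
  refine Γ.eq_of_forall_edge_eq (fun e => ?_) p q
  have := (Finset.sum_eq_zero_iff_of_nonneg fun e _ =>
    div_nonneg (mul_self_nonneg _) (Γ.length_pos e).le).1 h e (Finset.mem_univ e)
  rw [div_eq_zero_iff, mul_self_eq_zero, or_iff_left (Γ.length_pos e).ne'] at this
  linarith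

-- Summation by parts: pairing f with the point mass at p gives the Laplacian of f at p.
open Classical in
theorem sum_mul_energy_single [Fintype V] [Fintype E] (Γ : MetrizedGraph V E) (f h : V → ℝ) :
    ∑ p, h p * Γ.energy f (Pi.single p 1) = Γ.energy f h := by
  simp only [energy, Finset.mul_sum]
  rw [Finset.sum_comm]
  refine Finset.sum_congr rfl fun e _ => ?_
  have (q : V) : ∑ p, h p * (Pi.single p (1 : ℝ) : V → ℝ) q = h q := by
    simp [Pi.single_apply]
  rw [← this (Γ.source e), ← this (Γ.target e), ← Finset.sum_sub_distrib, Finset.mul_sum,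
    Finset.sum_div]
  exact Finset.sum_congr rfl fun _ _ => by ring

/-- The Laplacian has only constants in its kernel, so adding the sum functional makes it
invertible; G is the inverse matrix. Its column sums are 1/v instead of the usual 0, a constant
shift of G that resistances do not see. -/
theorem exists_green [Fintype V] [Fintype E] (Γ : MetrizedGraph V E) :
    ∃ G : V → V → ℝ, (∀ p q, G p q = G q p) ∧ (∀ q, ∑ p, G p q = 1 / Fintype.card V) ∧
      ∀ (h : V → ℝ) (q : V), Γ.energy h (fun p => G p q) = h q - (∑ p, h p) / Fintype.card V := by
  classical
  have := Γ.connected.nonempty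
  let T : (V → ℝ) →ₗ[ℝ] (V → ℝ) :=
    { toFun := fun f p => Γ.energy f (Pi.single p 1) + ∑ q, f q
      map_add' := fun f h => by
        ext p
        simp only [energy, Pi.add_apply, Finset.sum_add_distrib]
        rw [add_add_add_comm]
        refine congrArg₂ _ ?_ rfl
        rw [← Finset.sum_add_distrib]
        exact Finset.sum_congr rfl fun _ _ => by ring
      map_smul' := fun c f => by
        ext p
        simp only [energy, Pi.smul_apply, smul_eq_mul, RingHom.id_apply, mul_add, Finset.mul_sum]
        congr 1
        exact Finset.sum_congr rfl fun _ _ => by ring }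
  have hT (f h : V → ℝ) : ∑ p, h p * T f p = Γ.energy f h + (∑ p, f p) * ∑ p, h p := by
    simp only [T, LinearMap.coe_mk, AddHom.coe_mk, mul_add, Finset.sum_add_distrib,
      sum_mul_energy_single, ← Finset.sum_mul]
    ring
  -- Pairing T f = 0 with f gives energy + (Σ f)² = 0: f is constant with sum zero.
  have hinj : Function.Injective T := by
    rw [← LinearMap.ker_eq_bot, LinearMap.ker_eq_bot']
    intro f hf
    have h0 := hT f f
    simp only [hf, Pi.zero_apply, mul_zero, Finset.sum_const_zero] at h0
    have h1 := Γ.energy_self_nonneg f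
    have h2 := mul_self_nonneg (∑ p, f p)
    have h3 := Γ.eq_of_energy_self_eq_zero (by linarith : Γ.energy f f = 0)
    have h4 : ∑ p, f p = 0 := mul_self_eq_zero.1 (by linarith)
    ext p
    rw [Finset.sum_congr rfl fun q _ => h3 q p] at h4
    simpa using h4
  choose G hG using fun q => LinearMap.injective_iff_surjective.1 hinj (Pi.single q 1)
  have hG' (h : V → ℝ) (q : V) : Γ.energy (G q) h + (∑ p, G q p) * ∑ p, h p = h q := by
    rw [← hT, hG]
    simp [Pi.single_apply]
  have hsum (q : V) : ∑ p, G q p = 1 / Fintype.card V := by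
    have := hG' (fun _ => 1) q
    rw [eq_div_iff (by simp)]
    simpa [energy] using this
  refine ⟨fun p q => G q p, fun p q => ?_, hsum, fun h q => ?_⟩
  · have h1 := hG' (G p) q
    have h2 := hG' (G q) p
    rw [energy_comm] at h2
    simp only
    linarith
  · have := hG' h q
    rw [energy_comm, hsum] at this
    simp only
    rw [← this]
    ring

/-- The Green function of the vertex Laplacian. -/
noncomputable def green [Fintype V] [Fintype E] (Γ : MetrizedGraph V E) : V → V → ℝ :=
  Γ.exists_green.choose

/-! ### Effective resistance and identities for the diagonal of G. -/

section VertexGreen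

variable [Fintype V] [Fintype E] (Γ : MetrizedGraph V E)

theorem green_comm (p q : V) : Γ.green p q = Γ.green q p :=
  Γ.exists_green.choose_spec.1 p q

theorem sum_green (q : V) : ∑ p, Γ.green p q = 1 / Fintype.card V :=
  Γ.exists_green.choose_spec.2.1 q

theorem energy_green (h : V → ℝ) (q : V) :
    Γ.energy h (fun p => Γ.green p q) = h q - (∑ p, h p) / Fintype.card V :=
  Γ.exists_green.choose_spec.2.2 h q

/-- The effective resistance between two vertices. -/
noncomputable def res (p q : V) : ℝ := Γ.green p p - 2 * Γ.green p q + Γ.green q q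

/-- The effective resistance between the end points of an edge. -/
noncomputable def edgeRes (e : E) : ℝ := Γ.res (Γ.source e) (Γ.target e)

/-- A weighted trace: apply `energy_green` to the point mass at p, weight by h p, sum over p and
regroup by edges. -/
theorem sum_sub_average (h : V → ℝ) :
    ∑ p, h p - (∑ p, h p) / Fintype.card V =
      ∑ e, (h (Γ.source e) * (Γ.green (Γ.source e) (Γ.source e) -
          Γ.green (Γ.source e) (Γ.target e)) +
        h (Γ.target e) * (Γ.green (Γ.target e) (Γ.target e) -
          Γ.green (Γ.source e) (Γ.target e))) / Γ.length e := by
  classical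
  have h1 (p : V) : h p - h p / Fintype.card V =
      h p * Γ.energy (Pi.single p 1) (fun q => Γ.green q p) := by
    rw [energy_green]
    simp [Pi.single_apply]
    ring
  rw [Finset.sum_div, ← Finset.sum_sub_distrib, Finset.sum_congr rfl fun p _ => h1 p]
  simp only [energy, Finset.mul_sum]
  rw [Finset.sum_comm]
  refine Finset.sum_congr rfl fun e _ => ?_
  have h2 (q : V) (k : V → ℝ) : ∑ p, h p * (Pi.single p (1 : ℝ) : V → ℝ) q * k p = h q * k q := by
    simp [Pi.single_apply]
  have h3 := h2 (Γ.source e) fun p => Γ.green (Γ.source e) p - Γ.green (Γ.target e) p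
  have h4 := h2 (Γ.target e) fun p => Γ.green (Γ.source e) p - Γ.green (Γ.target e) p
  rw [Γ.green_comm (Γ.target e) (Γ.source e)] at h3
  calc _ = (∑ p, h p * (Pi.single p (1 : ℝ) : V → ℝ) (Γ.source e) *
            (Γ.green (Γ.source e) p - Γ.green (Γ.target e) p) -
          ∑ p, h p * (Pi.single p (1 : ℝ) : V → ℝ) (Γ.target e) *
            (Γ.green (Γ.source e) p - Γ.green (Γ.target e) p)) / Γ.length e := by
        rw [← Finset.sum_sub_distrib, Finset.sum_div]
        exact Finset.sum_congr rfl fun _ _ => by ring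
    _ = _ := by
        rw [h3, h4]
        ring

/-- Foster's theorem. -/
theorem sum_edgeRes_div_length : ∑ e, Γ.edgeRes e / Γ.length e = Fintype.card V - 1 := by
  have := Γ.connected.nonempty
  have h := Γ.sum_sub_average fun _ => 1
  simp only [Finset.sum_const, Finset.card_univ, nsmul_eq_mul, mul_one, one_mul] at h
  rw [div_self (by simp)] at h
  rw [h]
  exact Finset.sum_congr rfl fun e _ => by rw [edgeRes, res]; ring

/-- The integral against the canonical measure of the function that interpolates `a` affinely
along the edges. -/
noncomputable def canonicalSum (a : V → ℝ) : ℝ :=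
  ∑ p, a p - 1 / 2 * ∑ e, Γ.edgeRes e / Γ.length e * (a (Γ.source e) + a (Γ.target e))

/-- Weak form of the fact that the Laplacian of p ↦ G(p,p) is twice the canonical measure minus
twice the uniform one. Edge by edge, it differs from twice `sum_sub_average` by a multiple of R_e.
-/
theorem energy_green_self (h : V → ℝ) :
    Γ.energy (fun p => Γ.green p p) h =
      2 * Γ.canonicalSum h - 2 * ((∑ p, h p) / Fintype.card V) := by
  have h1 := Γ.sum_sub_average h
  have h2 : Γ.energy (fun p => Γ.green p p) h =
      2 * (∑ p, h p - (∑ p, h p) / Fintype.card V) -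
        ∑ e, Γ.edgeRes e / Γ.length e * (h (Γ.source e) + h (Γ.target e)) := by
    rw [h1, Finset.mul_sum, ← Finset.sum_sub_distrib, energy]
    exact Finset.sum_congr rfl fun e _ => by rw [edgeRes, res]; ring
  rw [h2, canonicalSum]
  ring

/-- The constant value of `green p p - 2 * canonicalSum (green p)`. -/
noncomputable def greenConst : ℝ :=
  (∑ p, Γ.green p p) / Fintype.card V - 2 / (Fintype.card V : ℝ) ^ 2

/-- Compute the energy of the diagonal against the column G(·,q) in two ways. -/
theorem green_self_sub (q : V) :
    Γ.green q q - 2 * Γ.canonicalSum (fun p => Γ.green p q) = Γ.greenConst := by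
  have h1 := Γ.energy_green_self fun p => Γ.green p q
  have h2 := Γ.energy_green (fun p => Γ.green p p) q
  rw [sum_green] at h1
  rw [greenConst]
  have : (1 / (Fintype.card V : ℝ)) / Fintype.card V = 1 / (Fintype.card V : ℝ) ^ 2 := by
    rw [div_div, sq]
  rw [this] at h1
  linear_combination h1 - h2

/-- Up to a constant, r(·,y) is the diagonal minus twice the column at y; when the square is
expanded, the terms depending on y cancel. -/
theorem energy_res (y : V) :
    Γ.energy (fun p => Γ.res p y) (fun p => Γ.res p y) =
      2 * (Γ.greenConst + Γ.canonicalSum fun p => Γ.green p p) := by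
  have h1 := Γ.energy_green_self fun p => Γ.green p p
  have h2 := Γ.energy_green (fun p => Γ.green p p) y
  have h3 := Γ.energy_green (fun p => Γ.green p y) y
  rw [sum_green] at h3
  have h4 : Γ.energy (fun p => Γ.res p y) (fun p => Γ.res p y) =
      Γ.energy (fun p => Γ.green p p) (fun p => Γ.green p p) -
        4 * Γ.energy (fun p => Γ.green p p) (fun p => Γ.green p y) +
        4 * Γ.energy (fun p => Γ.green p y) (fun p => Γ.green p y) := by
    simp only [energy, Finset.mul_sum, ← Finset.sum_sub_distrib, ← Finset.sum_add_distrib]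
    exact Finset.sum_congr rfl fun e _ => by simp only [res]; ring
  have : (1 / (Fintype.card V : ℝ)) / Fintype.card V = 1 / (Fintype.card V : ℝ) ^ 2 := by
    rw [div_div, sq]
  rw [this] at h3
  rw [h4, h1, h2, h3, greenConst]
  ring

theorem canonicalSum_one : Γ.canonicalSum (fun _ => 1) = 1 := by
  have := Γ.sum_edgeRes_div_length
  rw [canonicalSum, ← Finset.sum_mul, this]
  simp
  ring

end VertexGreen

/-! ### Points, interpolation, edge bubbles and one-sided slopes. -/

section Points

variable (Γ : MetrizedGraph V E)

theorem pt_zero (e : E) : Γ.pt e 0 = Point.vertex (Γ.source e) := by simp [pt]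

theorem pt_length (e : E) : Γ.pt e (Γ.length e) = Point.vertex (Γ.target e) := by
  simp [pt, Γ.length_pos e]

theorem pt_of_mem {e : E} {t : ℝ} (ht : t ∈ Ioo 0 (Γ.length e)) :
    Γ.pt e t = Point.inner e t ht := by
  rw [pt, dif_neg (not_le.2 ht.1), dif_neg (not_le.2 ht.2)]

theorem pt_injOn (e : E) : InjOn (Γ.pt e) (Ioo 0 (Γ.length e)) := by
  intro s hs t ht h
  rw [pt_of_mem _ hs, pt_of_mem _ ht] at h
  injection h

theorem continuous_iff {X : Type*} [TopologicalSpace X] {f : Γ.Point → X} :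
    Continuous f ↔ ∀ e, ContinuousOn (fun t => f (Γ.pt e t)) (Icc 0 (Γ.length e)) := by
  rw [continuous_iSup_dom]
  refine forall_congr' fun e => ?_
  rw [continuous_coinduced_dom, continuousOn_iff_continuous_domRestrict]
  rfl

theorem pt_projIcc (e : E) (t : ℝ) :
    Γ.pt e (projIcc 0 (Γ.length e) (Γ.length_pos e).le t) = Γ.pt e t := by
  rcases le_total t 0 with h | h
  · rw [projIcc_of_le_left _ h]
    simp [pt, h]
  rcases le_total (Γ.length e) t with h' | h'
  · rw [projIcc_of_right_le _ h']
    have := Γ.length_pos e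
    simp [pt, h', not_le.2 this, not_le.2 (this.trans_le h')]
  · rw [projIcc_of_mem _ ⟨h, h'⟩]

theorem continuous_pt (e : E) : Continuous (Γ.pt e) := by
  have h : Continuous fun t : Icc (0 : ℝ) (Γ.length e) => Γ.pt e t :=
    continuous_iSup_rng (i := e) continuous_coinduced_rng
  have := h.comp (continuous_projIcc (h := (Γ.length_pos e).le))
  refine this.congr fun t => Γ.pt_projIcc e t

/-- The extension of a function on the vertices that is affine along the edges. -/
noncomputable def lin (f : V → ℝ) : Γ.Point → ℝ
  | Point.vertex p => f p
  | Point.inner e t _ => (1 - t / Γ.length e) * f (Γ.source e) + t / Γ.length e * f (Γ.target e)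

@[simp] theorem lin_vertex (f : V → ℝ) (p : V) : Γ.lin f (Point.vertex p) = f p := rfl

theorem lin_inner (f : V → ℝ) (e : E) (t : ℝ) (ht : t ∈ Ioo 0 (Γ.length e)) :
    Γ.lin f (Point.inner e t ht) =
      (1 - t / Γ.length e) * f (Γ.source e) + t / Γ.length e * f (Γ.target e) := rfl

theorem lin_pt (f : V → ℝ) (e : E) {t : ℝ} (ht : t ∈ Icc 0 (Γ.length e)) :
    Γ.lin f (Γ.pt e t) =
      (1 - t / Γ.length e) * f (Γ.source e) + t / Γ.length e * f (Γ.target e) := by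
  rcases ht.1.eq_or_lt with rfl | h
  · simp [pt_zero]
  rcases ht.2.eq_or_lt with rfl | h'
  · simp [pt_length, (Γ.length_pos e).ne']
  · rw [pt_of_mem _ (mem_Ioo.2 ⟨h, h'⟩), lin_inner]

/-- The weights do not depend on f, so identities linear in vertex values pass from vertices to all
points. -/
theorem exists_lin_eq (x : Γ.Point) : ∃ (p q : V) (a b : ℝ), 0 ≤ a ∧ 0 ≤ b ∧ a + b = 1 ∧
    ∀ f : V → ℝ, Γ.lin f x = a * f p + b * f q := by
  cases x with
  | vertex p => exact ⟨p, p, 1, 0, by norm_num, le_rfl, by norm_num, fun f => by simp⟩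
  | inner e t ht =>
    refine ⟨_, _, 1 - t / Γ.length e, t / Γ.length e, ?_, ?_, by ring, fun f => rfl⟩
    · rw [sub_nonneg, div_le_one (Γ.length_pos e)]
      exact ht.2.le
    · exact div_nonneg ht.1.le (Γ.length_pos e).le

open Classical in
/-- The Green function of the Dirichlet Laplacian on the edges, zero for points that are not in
the interior of the same edge. -/
noncomputable def bub : Γ.Point → Γ.Point → ℝ
  | Point.inner e s _, Point.inner e' t _ => if e = e' then min s t - s * t / Γ.length e else 0
  | _, _ => 0

@[simp] theorem bub_vertex_left (p : V) (x : Γ.Point) : Γ.bub (Point.vertex p) x = 0 := by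
  cases x <;> rfl

@[simp] theorem bub_vertex_right (p : V) (x : Γ.Point) : Γ.bub x (Point.vertex p) = 0 := by
  cases x <;> rfl

theorem bub_inner (e : E) {s t : ℝ} (hs : s ∈ Ioo 0 (Γ.length e)) (ht : t ∈ Ioo 0 (Γ.length e)) :
    Γ.bub (Point.inner e s hs) (Point.inner e t ht) = min s t - s * t / Γ.length e := by
  simp [bub]

theorem bub_comm (x y : Γ.Point) : Γ.bub x y = Γ.bub y x := by
  classical
  cases x <;> cases y <;> try rfl
  simp only [bub]
  split_ifs with h h' h'
  · subst h
    rw [min_comm, mul_comm]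
  · exact absurd h.symm h'
  · exact absurd h'.symm h
  · rfl

theorem bub_pt_inner (e : E) {s t : ℝ} (hs : s ∈ Ioo 0 (Γ.length e))
    (ht : t ∈ Icc 0 (Γ.length e)) :
    Γ.bub (Γ.pt e t) (Point.inner e s hs) = min t s - t * s / Γ.length e := by
  rcases ht.1.eq_or_lt with rfl | h
  · simp [pt_zero, hs.1.le]
  rcases ht.2.eq_or_lt with rfl | h'
  · rw [pt_length, bub_vertex_left, min_eq_right hs.2.le]
    have := (Γ.length_pos e).ne'
    field_simp
    ring
  · rw [pt_of_mem _ (mem_Ioo.2 ⟨h, h'⟩), bub_inner]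

theorem bub_pt_inner_of_ne {e e' : E} (h : e' ≠ e) {s : ℝ} (hs : s ∈ Ioo 0 (Γ.length e))
    (t : ℝ) : Γ.bub (Γ.pt e' t) (Point.inner e s hs) = 0 := by
  unfold pt
  split_ifs <;> simp [bub, h]

theorem continuous_lin (f : V → ℝ) : Continuous (Γ.lin f) := by
  rw [continuous_iff]
  intro e
  refine ContinuousOn.congr ?_ fun t ht => Γ.lin_pt f e ht
  fun_prop

theorem continuous_bub (y : Γ.Point) : Continuous fun x => Γ.bub x y := by
  cases y with
  | vertex p => simpa using continuous_const
  | inner e s hs =>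
    rw [continuous_iff]
    intro e'
    rcases eq_or_ne e' e with rfl | h
    · refine ContinuousOn.congr ?_ fun t ht => Γ.bub_pt_inner e' hs ht
      fun_prop
    · simpa [bub_pt_inner_of_ne _ h] using continuousOn_const

theorem isPiecewiseAffine_lin (f : V → ℝ) : Γ.IsPiecewiseAffine (Γ.lin f) := by
  refine ⟨∅, finite_empty, fun e a b ha hb _ => ⟨(f (Γ.target e) - f (Γ.source e)) / Γ.length e,
    f (Γ.source e), fun t ht => ?_⟩⟩
  rw [lin_pt _ _ _ ⟨ha.trans ht.1.le, ht.2.le.trans hb⟩]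
  ring

theorem isPiecewiseAffine_bub (y : Γ.Point) : Γ.IsPiecewiseAffine fun x => Γ.bub x y := by
  cases y with
  | vertex p => exact ⟨∅, finite_empty, fun e a b ha hb _ => ⟨0, 0, fun t ht => by simp⟩⟩
  | inner e s hs =>
    refine ⟨{Point.inner e s hs}, finite_singleton _, fun e' a b ha hb h => ?_⟩
    rcases eq_or_ne e' e with rfl | he
    · have hsab : s ∉ Ioo a b := fun hmem => h s hmem (Γ.pt_of_mem hs)
      rcases le_or_gt s a with hsa | hsa
      · refine ⟨-s / Γ.length e', s, fun t ht => ?_⟩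
        beta_reduce
        rw [bub_pt_inner _ _ hs ⟨ha.trans ht.1.le, ht.2.le.trans hb⟩,
          min_eq_right (hsa.trans ht.1.le)]
        ring
      · have hbs : b ≤ s := by
          by_contra hlt
          exact hsab ⟨hsa, not_le.1 hlt⟩
        refine ⟨1 - s / Γ.length e', 0, fun t ht => ?_⟩
        beta_reduce
        rw [bub_pt_inner _ _ hs ⟨ha.trans ht.1.le, ht.2.le.trans hb⟩,
          min_eq_left (ht.2.le.trans hbs)]
        ring
    · exact ⟨0, 0, fun t _ => by simp [bub_pt_inner_of_ne _ he]⟩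

variable {Γ}

theorem IsPiecewiseAffine.add {f h : Γ.Point → ℝ} (hf : Γ.IsPiecewiseAffine f)
    (hh : Γ.IsPiecewiseAffine h) : Γ.IsPiecewiseAffine fun x => f x + h x := by
  obtain ⟨S, hS, hf⟩ := hf
  obtain ⟨T, hT, hh⟩ := hh
  refine ⟨S ∪ T, hS.union hT, fun e a b ha hb h => ?_⟩
  obtain ⟨c, d, h1⟩ := hf e a b ha hb fun t ht hm => h t ht (Or.inl hm)
  obtain ⟨c', d', h2⟩ := hh e a b ha hb fun t ht hm => h t ht (Or.inr hm)
  exact ⟨c + c', d + d', fun t ht => by beta_reduce; rw [h1 t ht, h2 t ht]; ring⟩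

theorem IsPiecewiseAffine.neg {f : Γ.Point → ℝ} (hf : Γ.IsPiecewiseAffine f) :
    Γ.IsPiecewiseAffine fun x => -f x := by
  obtain ⟨S, hS, hf⟩ := hf
  refine ⟨S, hS, fun e a b ha hb h => ?_⟩
  obtain ⟨c, d, h1⟩ := hf e a b ha hb h
  exact ⟨-c, -d, fun t ht => by beta_reduce; rw [h1 t ht]; ring⟩

theorem IsPiecewiseAffine.sub {f h : Γ.Point → ℝ} (hf : Γ.IsPiecewiseAffine f)
    (hh : Γ.IsPiecewiseAffine h) : Γ.IsPiecewiseAffine fun x => f x - h x := by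
  simpa only [sub_eq_add_neg] using hf.add hh.neg

theorem isPiecewiseAffine_const (c : ℝ) : Γ.IsPiecewiseAffine fun _ => c :=
  ⟨∅, finite_empty, fun _ _ _ _ _ _ => ⟨0, c, fun _ _ => by ring⟩⟩

variable (Γ)

/-- `f` is affine with slope `c` along an initial piece of the direction that leads from the point
`t` of the edge `e` towards the target of `e`. -/
def HasSlopeRight (f : Γ.Point → ℝ) (e : E) (t c : ℝ) : Prop :=
  ∃ u, t < u ∧ ∀ s ∈ Icc t u, f (Γ.pt e s) = f (Γ.pt e t) + c * (s - t)

/-- `f` is affine with slope `c` along an initial piece of the direction that leads from the point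
`t` of the edge `e` towards the source of `e`. -/
def HasSlopeLeft (f : Γ.Point → ℝ) (e : E) (t c : ℝ) : Prop :=
  ∃ u, u < t ∧ ∀ s ∈ Icc u t, f (Γ.pt e s) = f (Γ.pt e t) + c * (t - s)

variable {Γ} {f h : Γ.Point → ℝ} {e : E} {t c d : ℝ}

theorem HasSlopeRight.forwardDeriv_eq (hf : Γ.HasSlopeRight f e t c) :
    Γ.forwardDeriv f e t = c := by
  obtain ⟨u, hu, hf⟩ := hf
  have h1 : HasDerivWithinAt (fun s => f (Γ.pt e t) + c * (s - t)) c (Ici t) t := by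
    simpa using! ((((hasDerivAt_id t).sub_const t).const_mul c).const_add
      (f (Γ.pt e t))).hasDerivWithinAt (s := Ici t)
  refine HasDerivWithinAt.derivWithin (h1.congr_of_eventuallyEq ?_ (by simp))
    (uniqueDiffWithinAt_Ici t)
  filter_upwards [Icc_mem_nhdsGE hu] with s hs using hf s hs

theorem HasSlopeLeft.backwardDeriv_eq (hf : Γ.HasSlopeLeft f e t c) :
    Γ.backwardDeriv f e t = c := by
  obtain ⟨u, hu, hf⟩ := hf
  have h1 : HasDerivWithinAt (fun s => f (Γ.pt e t) + c * (t - s)) (-c) (Iic t) t := by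
    simpa using! ((((hasDerivAt_id t).const_sub t).const_mul c).const_add
      (f (Γ.pt e t))).hasDerivWithinAt (s := Iic t)
  rw [backwardDeriv, HasDerivWithinAt.derivWithin (h1.congr_of_eventuallyEq ?_ (by simp))
    (uniqueDiffWithinAt_Iic t), neg_neg]
  filter_upwards [Icc_mem_nhdsLE hu] with s hs using hf s hs

theorem HasSlopeRight.sub (hf : Γ.HasSlopeRight f e t c) (hh : Γ.HasSlopeRight h e t d) :
    Γ.HasSlopeRight (fun x => f x - h x) e t (c - d) := by
  obtain ⟨u, hu, hf⟩ := hf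
  obtain ⟨v, hv, hh⟩ := hh
  refine ⟨min u v, lt_min hu hv, fun s hs => ?_⟩
  beta_reduce
  rw [hf s ⟨hs.1, hs.2.trans (min_le_left _ _)⟩, hh s ⟨hs.1, hs.2.trans (min_le_right _ _)⟩]
  ring

theorem HasSlopeLeft.sub (hf : Γ.HasSlopeLeft f e t c) (hh : Γ.HasSlopeLeft h e t d) :
    Γ.HasSlopeLeft (fun x => f x - h x) e t (c - d) := by
  obtain ⟨u, hu, hf⟩ := hf
  obtain ⟨v, hv, hh⟩ := hh
  refine ⟨max u v, max_lt hu hv, fun s hs => ?_⟩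
  beta_reduce
  rw [hf s ⟨(le_max_left _ _).trans hs.1, hs.2⟩, hh s ⟨(le_max_right _ _).trans hs.1, hs.2⟩]
  ring

theorem eqOn_Icc_of_avoids (hc : Continuous f) {c d : ℝ} {a b : ℝ} (hab : a < b)
    (hf : ∀ s ∈ Ioo a b, f (Γ.pt e s) = c * s + d) :
    ∀ s ∈ Icc a b, f (Γ.pt e s) = c * s + d := by
  have h1 : EqOn (fun s => f (Γ.pt e s)) (fun s => c * s + d) (closure (Ioo a b)) :=
    EqOn.closure hf (hc.comp (Γ.continuous_pt e)) (by fun_prop)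
  rwa [closure_Ioo hab.ne] at h1

theorem finite_edge_preimage {S : Set Γ.Point} (hS : S.Finite) (e : E) :
    (Ioo 0 (Γ.length e) ∩ Γ.pt e ⁻¹' S).Finite := by
  refine Finite.of_finite_image (f := Γ.pt e) (hS.subset ?_)
    ((Γ.pt_injOn e).mono inter_subset_left)
  rintro _ ⟨s, hs, rfl⟩
  exact hs.2

theorem exists_hasSlopeRight (hc : Continuous f) (hf : Γ.IsPiecewiseAffine f)
    (ht : t ∈ Ico 0 (Γ.length e)) : ∃ c, Γ.HasSlopeRight f e t c := by
  obtain ⟨S, hS, hf⟩ := hf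
  -- The point t may itself be exceptional; the other exceptional points form a finite, hence
  -- closed, set that a short interval to the right of t avoids.
  have hT := ((finite_edge_preimage hS e).subset (sdiff_subset (t := {t}))).isClosed
  obtain ⟨u, hu, hut⟩ := mem_nhdsGE_iff_exists_Icc_subset.1 (Filter.inter_mem
    (mem_nhdsWithin_of_mem_nhds (hT.isOpen_compl.mem_nhds (by simp : t ∈ _)))
    (Icc_mem_nhdsGE ht.2))
  have hu' := (hut (right_mem_Icc.2 hu.le)).2.2
  obtain ⟨c, d, hcd⟩ := hf e t u ht.1 hu' fun s hs hm => (hut (Ioo_subset_Icc_self hs)).1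
    ⟨⟨⟨ht.1.trans_lt hs.1, hs.2.trans_le hu'⟩, hm⟩, hs.1.ne'⟩
  have := eqOn_Icc_of_avoids hc hu hcd
  refine ⟨c, u, hu, fun s hs => ?_⟩
  rw [this s hs, this t (left_mem_Icc.2 (le_of_lt hu))]
  ring

theorem exists_hasSlopeLeft (hc : Continuous f) (hf : Γ.IsPiecewiseAffine f)
    (ht : t ∈ Ioc 0 (Γ.length e)) : ∃ c, Γ.HasSlopeLeft f e t c := by
  obtain ⟨S, hS, hf⟩ := hf
  have hT := ((finite_edge_preimage hS e).subset (sdiff_subset (t := {t}))).isClosed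
  obtain ⟨u, hu, hut⟩ := mem_nhdsLE_iff_exists_Icc_subset.1 (Filter.inter_mem
    (mem_nhdsWithin_of_mem_nhds (hT.isOpen_compl.mem_nhds (by simp : t ∈ _)))
    (Icc_mem_nhdsLE ht.1))
  have hu' := (hut (left_mem_Icc.2 hu.le)).2.1
  obtain ⟨c, d, hcd⟩ := hf e u t hu' ht.2 fun s hs hm => (hut (Ioo_subset_Icc_self hs)).1
    ⟨⟨⟨hu'.trans_lt hs.1, hs.2.trans_le ht.2⟩, hm⟩, hs.2.ne⟩
  have := eqOn_Icc_of_avoids hc hu hcd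
  refine ⟨-c, u, hu, fun s hs => ?_⟩
  rw [this s hs, this t (right_mem_Icc.2 (le_of_lt hu))]
  ring

/-- `derivWithin` is subtractive only where derivatives exist; continuity and piecewise affinity
provide the one-sided slopes. -/
theorem slopeSum_sub [Fintype E] (hcf : Continuous f) (hf : Γ.IsPiecewiseAffine f)
    (hch : Continuous h) (hh : Γ.IsPiecewiseAffine h) (x : Γ.Point) :
    Γ.slopeSum (fun x => f x - h x) x = Γ.slopeSum f x - Γ.slopeSum h x := by
  classical
  have hR (e : E) {t : ℝ} (ht : t ∈ Ico 0 (Γ.length e)) :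
      Γ.forwardDeriv (fun x => f x - h x) e t = Γ.forwardDeriv f e t - Γ.forwardDeriv h e t := by
    obtain ⟨c, hc⟩ := exists_hasSlopeRight hcf hf ht
    obtain ⟨d, hd⟩ := exists_hasSlopeRight hch hh ht
    rw [hc.forwardDeriv_eq, hd.forwardDeriv_eq, (hc.sub hd).forwardDeriv_eq]
  have hL (e : E) {t : ℝ} (ht : t ∈ Ioc 0 (Γ.length e)) :
      Γ.backwardDeriv (fun x => f x - h x) e t =
        Γ.backwardDeriv f e t - Γ.backwardDeriv h e t := by
    obtain ⟨c, hc⟩ := exists_hasSlopeLeft hcf hf ht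
    obtain ⟨d, hd⟩ := exists_hasSlopeLeft hch hh ht
    rw [hc.backwardDeriv_eq, hd.backwardDeriv_eq, (hc.sub hd).backwardDeriv_eq]
  cases x with
  | vertex p =>
    simp only [slopeSum, hR _ (left_mem_Ico.2 (Γ.length_pos _)),
      hL _ (right_mem_Ioc.2 (Γ.length_pos _)), Finset.sum_sub_distrib]
    ring
  | inner e t ht =>
    simp only [slopeSum, hR e ⟨ht.1.le, ht.2⟩, hL e ⟨ht.1, ht.2.le⟩]
    ring

end Points

/-! ### Laplacians of interpolations and bubbles, and uniqueness of voltages. -/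

section Slopes

variable (Γ : MetrizedGraph V E)

theorem hasSlopeRight_lin (f : V → ℝ) (e : E) {t : ℝ} (ht : t ∈ Ico 0 (Γ.length e)) :
    Γ.HasSlopeRight (Γ.lin f) e t ((f (Γ.target e) - f (Γ.source e)) / Γ.length e) := by
  refine ⟨_, ht.2, fun s hs => ?_⟩
  rw [lin_pt _ _ _ ⟨ht.1.trans hs.1, hs.2⟩, lin_pt _ _ _ ⟨ht.1, ht.2.le⟩]
  ring

theorem hasSlopeLeft_lin (f : V → ℝ) (e : E) {t : ℝ} (ht : t ∈ Ioc 0 (Γ.length e)) :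
    Γ.HasSlopeLeft (Γ.lin f) e t ((f (Γ.source e) - f (Γ.target e)) / Γ.length e) := by
  refine ⟨_, ht.1, fun s hs => ?_⟩
  rw [lin_pt _ _ _ ⟨hs.1, hs.2.trans ht.2⟩, lin_pt _ _ _ ⟨ht.1.le, ht.2⟩]
  ring

theorem hasSlopeRight_bub_of_lt (e : E) {s t : ℝ} (hs : s ∈ Ioo 0 (Γ.length e)) (ht : 0 ≤ t)
    (hts : t < s) : Γ.HasSlopeRight (fun x => Γ.bub x (Point.inner e s hs)) e t
      (1 - s / Γ.length e) := by
  refine ⟨s, hts, fun r hr => ?_⟩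
  beta_reduce
  rw [bub_pt_inner _ _ _ ⟨ht.trans hr.1, hr.2.trans hs.2.le⟩,
    bub_pt_inner _ _ _ ⟨ht, hts.le.trans hs.2.le⟩, min_eq_left hr.2, min_eq_left hts.le]
  ring

theorem hasSlopeRight_bub_of_le (e : E) {s t : ℝ} (hs : s ∈ Ioo 0 (Γ.length e))
    (ht : t < Γ.length e) (hts : s ≤ t) :
    Γ.HasSlopeRight (fun x => Γ.bub x (Point.inner e s hs)) e t (-(s / Γ.length e)) := by
  refine ⟨_, ht, fun r hr => ?_⟩
  beta_reduce
  rw [bub_pt_inner _ _ _ ⟨(hs.1.le.trans hts).trans hr.1, hr.2⟩,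
    bub_pt_inner _ _ _ ⟨hs.1.le.trans hts, ht.le⟩, min_eq_right (hts.trans hr.1),
    min_eq_right hts]
  ring

theorem hasSlopeLeft_bub_of_le (e : E) {s t : ℝ} (hs : s ∈ Ioo 0 (Γ.length e)) (ht : 0 < t)
    (hts : t ≤ s) : Γ.HasSlopeLeft (fun x => Γ.bub x (Point.inner e s hs)) e t
      (-(1 - s / Γ.length e)) := by
  refine ⟨0, ht, fun r hr => ?_⟩
  beta_reduce
  rw [bub_pt_inner _ _ _ ⟨hr.1, (hr.2.trans hts).trans hs.2.le⟩,
    bub_pt_inner _ _ _ ⟨ht.le, hts.trans hs.2.le⟩, min_eq_left (hr.2.trans hts), min_eq_left hts]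
  ring

theorem hasSlopeLeft_bub_of_lt (e : E) {s t : ℝ} (hs : s ∈ Ioo 0 (Γ.length e))
    (ht : t ≤ Γ.length e) (hts : s < t) :
    Γ.HasSlopeLeft (fun x => Γ.bub x (Point.inner e s hs)) e t (s / Γ.length e) := by
  refine ⟨s, hts, fun r hr => ?_⟩
  beta_reduce
  rw [bub_pt_inner _ _ _ ⟨hs.1.le.trans hr.1, hr.2.trans ht⟩,
    bub_pt_inner _ _ _ ⟨(hs.1.trans hts).le, ht⟩, min_eq_right hr.1, min_eq_right hts.le]
  ring

theorem forwardDeriv_const (c : ℝ) (e : E) (t : ℝ) :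
    Γ.forwardDeriv (fun _ => c) e t = 0 := by simp [forwardDeriv]

theorem backwardDeriv_const (c : ℝ) (e : E) (t : ℝ) :
    Γ.backwardDeriv (fun _ => c) e t = 0 := by simp [backwardDeriv]

theorem forwardDeriv_bub_of_ne {e e' : E} (h : e' ≠ e) {s : ℝ} (hs : s ∈ Ioo 0 (Γ.length e))
    (t : ℝ) : Γ.forwardDeriv (fun x => Γ.bub x (Point.inner e s hs)) e' t = 0 := by
  simp [forwardDeriv, bub_pt_inner_of_ne _ h]

theorem backwardDeriv_bub_of_ne {e e' : E} (h : e' ≠ e) {s : ℝ} (hs : s ∈ Ioo 0 (Γ.length e))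
    (t : ℝ) : Γ.backwardDeriv (fun x => Γ.bub x (Point.inner e s hs)) e' t = 0 := by
  simp [backwardDeriv, bub_pt_inner_of_ne _ h]

variable [Fintype E]

theorem slopeSum_const (c : ℝ) (x : Γ.Point) : Γ.slopeSum (fun _ => c) x = 0 := by
  cases x <;> simp [slopeSum, forwardDeriv_const, backwardDeriv_const]

open Classical in
theorem slopeSum_lin_vertex (f : V → ℝ) (p : V) :
    Γ.slopeSum (Γ.lin f) (Point.vertex p) = -Γ.energy f (Pi.single p 1) := by
  rw [slopeSum, energy, Finset.sum_filter, Finset.sum_filter, ← Finset.sum_add_distrib,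
    ← Finset.sum_neg_distrib]
  refine Finset.sum_congr rfl fun e _ => ?_
  rw [(Γ.hasSlopeRight_lin f e (left_mem_Ico.2 (Γ.length_pos e))).forwardDeriv_eq,
    (Γ.hasSlopeLeft_lin f e (right_mem_Ioc.2 (Γ.length_pos e))).backwardDeriv_eq,
    Pi.single_apply, Pi.single_apply]
  split_ifs <;> ring

theorem slopeSum_lin_inner (f : V → ℝ) (e : E) (t : ℝ) (ht : t ∈ Ioo 0 (Γ.length e)) :
    Γ.slopeSum (Γ.lin f) (Point.inner e t ht) = 0 := by
  rw [slopeSum, (Γ.hasSlopeRight_lin f e ⟨ht.1.le, ht.2⟩).forwardDeriv_eq,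
    (Γ.hasSlopeLeft_lin f e ⟨ht.1, ht.2.le⟩).backwardDeriv_eq]
  ring

-- The slopes of a bubble at the two ends of its edge, 1 - s/L and s/L, are exactly the
-- interpolation weights of its peak.
open Classical in
theorem slopeSum_bub_vertex (p : V) (y : Γ.Point) :
    Γ.slopeSum (fun x => Γ.bub x y) (Point.vertex p) =
      Γ.lin (Pi.single p 1) y - if Point.vertex p = y then 1 else 0 := by
  cases y with
  | vertex q =>
    simp only [bub_vertex_right, slopeSum_const, lin_vertex, Pi.single_apply, Point.vertex.injEq,
      eq_comm, sub_self]
  | inner e s hs =>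
    rw [slopeSum, Finset.sum_filter, Finset.sum_filter, ← Finset.sum_add_distrib,
      Finset.sum_eq_single e, (Γ.hasSlopeRight_bub_of_lt e hs le_rfl hs.1).forwardDeriv_eq,
      (Γ.hasSlopeLeft_bub_of_lt e hs le_rfl hs.2).backwardDeriv_eq, lin_inner,
      Pi.single_apply, Pi.single_apply]
    · simp
    · intro e' _ he
      simp [forwardDeriv_bub_of_ne _ he, backwardDeriv_bub_of_ne _ he]
    · simp

open Classical in
theorem slopeSum_bub_inner (e : E) (t : ℝ) (ht : t ∈ Ioo 0 (Γ.length e)) (y : Γ.Point) :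
    Γ.slopeSum (fun x => Γ.bub x y) (Point.inner e t ht) =
      -if Point.inner e t ht = y then 1 else 0 := by
  cases y with
  | vertex q => simp [slopeSum_const]
  | inner e' s hs =>
    rw [slopeSum]
    rcases eq_or_ne e e' with rfl | he
    · rcases lt_trichotomy t s with h | rfl | h
      · rw [(Γ.hasSlopeRight_bub_of_lt e hs ht.1.le h).forwardDeriv_eq,
          (Γ.hasSlopeLeft_bub_of_le e hs ht.1 h.le).backwardDeriv_eq, if_neg (by simp [h.ne])]
        ring
      · rw [(Γ.hasSlopeRight_bub_of_le e hs ht.2 le_rfl).forwardDeriv_eq,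
          (Γ.hasSlopeLeft_bub_of_le e hs ht.1 le_rfl).backwardDeriv_eq, if_pos rfl]
        ring
      · rw [(Γ.hasSlopeRight_bub_of_le e hs ht.2 h.le).forwardDeriv_eq,
          (Γ.hasSlopeLeft_bub_of_lt e hs ht.2.le h).backwardDeriv_eq, if_neg (by simp [h.ne'])]
        ring
    · rw [forwardDeriv_bub_of_ne _ he, backwardDeriv_bub_of_ne _ he, if_neg (by simp [he])]
      ring

/-- The two one-sided slopes are opposite, so h is affine near each interior point; its derivative
is locally constant, hence constant on the open edge. -/
theorem eq_lin_of_slopeSum_inner_eq_zero {h : Γ.Point → ℝ} (hc : Continuous h)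
    (hp : Γ.IsPiecewiseAffine h)
    (h0 : ∀ e t ht, Γ.slopeSum h (Point.inner e t ht) = 0) (x : Γ.Point) :
    h x = Γ.lin (fun p => h (Point.vertex p)) x := by
  cases x with
  | vertex p => rfl
  | inner e t ht =>
    have hloc : ∀ r ∈ Ioo 0 (Γ.length e), ∃ c, ∀ᶠ s in nhds r,
        h (Γ.pt e s) = h (Γ.pt e r) + c * (s - r) := by
      intro r hr
      obtain ⟨c, hR⟩ := exists_hasSlopeRight hc hp (e := e) ⟨hr.1.le, hr.2⟩
      obtain ⟨d, hL⟩ := exists_hasSlopeLeft hc hp (e := e) ⟨hr.1, hr.2.le⟩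
      have hcd := h0 e r hr
      rw [slopeSum, hR.forwardDeriv_eq, hL.backwardDeriv_eq] at hcd
      obtain ⟨u, hu, hR⟩ := hR
      obtain ⟨w, hw, hL⟩ := hL
      refine ⟨c, ?_⟩
      filter_upwards [Ioo_mem_nhds hw hu] with s hs
      rcases le_total r s with hrs | hrs
      · exact hR s ⟨hrs, hs.2.le⟩
      · rw [hL s ⟨hs.1.le, hrs⟩, eq_neg_of_add_eq_zero_right hcd]
        ring
    set φ : ℝ → ℝ := fun s => h (Γ.pt e s) with hφ
    have hder : ∀ r ∈ Ioo 0 (Γ.length e), ∃ c, ∀ᶠ s in nhds r, HasDerivAt φ c s := by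
      intro r hr
      obtain ⟨c, hc⟩ := hloc r hr
      refine ⟨c, ?_⟩
      filter_upwards [hc.eventually_nhds] with s hs
      have h1 : HasDerivAt (fun s => h (Γ.pt e r) + c * (s - r)) c s := by
        simpa using! (((hasDerivAt_id s).sub_const r).const_mul c).const_add (h (Γ.pt e r))
      exact h1.congr_of_eventuallyEq hs
    have hder2 : ∀ r ∈ Ioo 0 (Γ.length e), HasDerivAt (deriv φ) 0 r := by
      intro r hr
      obtain ⟨c, hc⟩ := hder r hr
      refine (hasDerivAt_const r c).congr_of_eventuallyEq ?_
      filter_upwards [hc] with s hs using hs.deriv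
    have hconst : ∀ r ∈ Ioo 0 (Γ.length e), deriv φ r = deriv φ t := fun r hr =>
      isOpen_Ioo.is_const_of_deriv_eq_zero isPreconnected_Ioo
        (fun s hs => (hder2 s hs).differentiableAt.differentiableWithinAt)
        (fun s hs => (hder2 s hs).deriv) hr ht
    have hder3 : ∀ r ∈ Ioo 0 (Γ.length e),
        HasDerivAt (fun s => φ s - deriv φ t * s) 0 r := by
      intro r hr
      obtain ⟨c, hc⟩ := hder r hr
      have h1 := hc.self_of_nhds
      have h2 := hconst r hr
      rw [h1.deriv] at h2
      subst h2
      simpa using! h1.sub ((hasDerivAt_id r).const_mul (deriv φ t))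
    have haff : ∀ r ∈ Ioo 0 (Γ.length e), h (Γ.pt e r) =
        deriv φ t * r + (φ t - deriv φ t * t) := fun r hr => by
      have := isOpen_Ioo.is_const_of_deriv_eq_zero isPreconnected_Ioo
        (fun s hs => (hder3 s hs).differentiableAt.differentiableWithinAt)
        (fun s hs => (hder3 s hs).deriv) hr ht
      linarith
    have hIcc := eqOn_Icc_of_avoids hc (Γ.length_pos e) haff
    have e0 := hIcc 0 (left_mem_Icc.2 (Γ.length_pos e).le)
    have e1 := hIcc _ (right_mem_Icc.2 (Γ.length_pos e).le)
    have e2 := hIcc t ⟨ht.1.le, ht.2.le⟩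
    rw [pt_zero] at e0
    rw [pt_length] at e1
    rw [pt_of_mem _ ht] at e2
    rw [lin_inner, e0, e1, e2]
    have := (Γ.length_pos e).ne'
    field_simp
    ring

/-- h interpolates a vertex function with zero Laplacian; pairing that function with itself gives
zero energy. -/
theorem eq_of_slopeSum_eq_zero [Fintype V] {h : Γ.Point → ℝ} (hc : Continuous h)
    (hp : Γ.IsPiecewiseAffine h) (h0 : ∀ x, Γ.slopeSum h x = 0) (x y : Γ.Point) : h x = h y := by
  classical
  have hlin := Γ.eq_lin_of_slopeSum_inner_eq_zero hc hp fun e t ht => h0 _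
  set f : V → ℝ := fun p => h (Point.vertex p)
  have he : Γ.energy f f = 0 := by
    rw [← sum_mul_energy_single]
    refine Finset.sum_eq_zero fun p _ => ?_
    have h1 := h0 (Point.vertex p)
    rw [funext hlin, slopeSum_lin_vertex, neg_eq_zero] at h1
    rw [h1, mul_zero]
  have hf := Γ.eq_of_energy_self_eq_zero he
  obtain ⟨p, q, a, b, -, -, hab, h1⟩ := Γ.exists_lin_eq x
  obtain ⟨p', q', a', b', -, -, hab', h2⟩ := Γ.exists_lin_eq y
  rw [hlin x, hlin y, h1, h2, hf p p', hf q p', hf q' p', ← add_mul, ← add_mul, hab, hab']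

theorem energy_lin (k : V → V → ℝ) (h : V → ℝ) (y : Γ.Point) :
    Γ.energy (fun r => Γ.lin (k r) y) h = Γ.lin (fun q => Γ.energy (fun r => k r q) h) y := by
  obtain ⟨p, q, a, b, -, -, -, h1⟩ := Γ.exists_lin_eq y
  simp only [h1, energy, Finset.mul_sum, ← Finset.sum_add_distrib]
  exact Finset.sum_congr rfl fun _ _ => by ring

/-! ### Green function on all of Γ and the voltage. -/

variable [Fintype V]

/-- The Green function on all points of the graph. -/
noncomputable def greenPt (x y : Γ.Point) : ℝ :=
  Γ.lin (fun p => Γ.lin (fun q => Γ.green p q) y) x + Γ.bub x y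

theorem greenPt_comm (x y : Γ.Point) : Γ.greenPt x y = Γ.greenPt y x := by
  obtain ⟨p, q, a, b, -, -, -, h1⟩ := Γ.exists_lin_eq x
  obtain ⟨p', q', a', b', -, -, -, h2⟩ := Γ.exists_lin_eq y
  simp only [greenPt, h1, h2]
  rw [bub_comm, Γ.green_comm p' p, Γ.green_comm p' q, Γ.green_comm q' p, Γ.green_comm q' q]
  ring

theorem continuous_greenPt (y : Γ.Point) : Continuous fun x => Γ.greenPt x y :=
  (Γ.continuous_lin _).add (Γ.continuous_bub y)

theorem isPiecewiseAffine_greenPt (y : Γ.Point) :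
    Γ.IsPiecewiseAffine fun x => Γ.greenPt x y :=
  (Γ.isPiecewiseAffine_lin _).add (Γ.isPiecewiseAffine_bub y)

-- Only the independence of c from y matters: c cancels in the difference of the Green functions at
-- y and z.
open Classical in
theorem exists_slopeSum_greenPt : ∃ c : Γ.Point → ℝ, ∀ x y,
    Γ.slopeSum (fun x => Γ.greenPt x y) x = c x - if x = y then 1 else 0 := by
  have hadd (x y : Γ.Point) : Γ.slopeSum (fun x => Γ.greenPt x y) x =
      Γ.slopeSum (Γ.lin (fun p => Γ.lin (fun q => Γ.green p q) y)) x +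
        Γ.slopeSum (fun x => Γ.bub x y) x := by
    have := slopeSum_sub (Γ.continuous_greenPt y) (Γ.isPiecewiseAffine_greenPt y)
      (Γ.continuous_bub y) (Γ.isPiecewiseAffine_bub y) x
    simp only [greenPt, add_sub_cancel_right] at this ⊢
    linarith
  refine ⟨fun x => match x with
    | Point.vertex _ => 1 / Fintype.card V
    | Point.inner _ _ _ => 0, fun x y => ?_⟩
  rw [hadd]
  cases x with
  | vertex p =>
    rw [slopeSum_lin_vertex, slopeSum_bub_vertex, energy_lin]
    have (q : V) : Γ.energy (fun r => Γ.green r q) (Pi.single p 1) =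
        (Pi.single p (1 : ℝ) : V → ℝ) q - 1 / Fintype.card V := by
      rw [energy_comm, energy_green]
      simp
    simp only [this]
    obtain ⟨p', q', a, b, -, -, hab, h1⟩ := Γ.exists_lin_eq y
    rw [h1, h1]
    linear_combination (1 / (Fintype.card V : ℝ)) * hab
  | inner e t ht =>
    rw [slopeSum_lin_inner, slopeSum_bub_inner]
    ring

theorem isVoltage_greenPt (z y : Γ.Point) : Γ.IsVoltage z y fun x =>
    Γ.greenPt x y - Γ.greenPt x z - (Γ.greenPt z y - Γ.greenPt z z) := by
  classical
  have hc : Continuous fun x => Γ.greenPt x y - Γ.greenPt x z :=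
    (Γ.continuous_greenPt y).sub (Γ.continuous_greenPt z)
  have hp := (Γ.isPiecewiseAffine_greenPt y).sub (Γ.isPiecewiseAffine_greenPt z)
  refine ⟨hc.sub continuous_const, hp.sub (isPiecewiseAffine_const _), by ring, fun x => ?_⟩
  obtain ⟨c, h⟩ := Γ.exists_slopeSum_greenPt
  rw [slopeSum_sub hc hp continuous_const (isPiecewiseAffine_const _), slopeSum_const,
    slopeSum_sub (Γ.continuous_greenPt y) (Γ.isPiecewiseAffine_greenPt y)
      (Γ.continuous_greenPt z) (Γ.isPiecewiseAffine_greenPt z), h, h]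
  ring

theorem IsVoltage.eq {Γ : MetrizedGraph V E} {z y : Γ.Point} {f h : Γ.Point → ℝ}
    (hf : Γ.IsVoltage z y f) (hh : Γ.IsVoltage z y h) : f = h := by
  ext x
  have := Γ.eq_of_slopeSum_eq_zero (h := fun x => f x - h x) (hf.1.sub hh.1) (hf.2.1.sub hh.2.1) (fun x => by
    have h1 := hf.2.2.2 x
    have h2 := hh.2.2.2 x
    rw [slopeSum_sub hf.1 hf.2.1 hh.1 hh.2.1]
    linarith) x z
  rw [hf.2.2.1, hh.2.2.1] at this
  linarith

/-- `voltage` is an `epsilon` choice, so existence and uniqueness together determine its value. -/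
theorem voltage_eq (z x y : Γ.Point) : Γ.voltage z x y =
    Γ.greenPt x y - Γ.greenPt x z - (Γ.greenPt z y - Γ.greenPt z z) :=
  congrFun (IsVoltage.eq (Classical.epsilon_spec (p := Γ.IsVoltage z y) ⟨_, Γ.isVoltage_greenPt z y⟩)
    (Γ.isVoltage_greenPt z y)) x

theorem voltage_self (z x : Γ.Point) : Γ.voltage z x x =
    Γ.greenPt x x - 2 * Γ.greenPt x z + Γ.greenPt z z := by
  rw [voltage_eq, Γ.greenPt_comm z x]
  ring

end Slopes

/-! ### Integrals against signed measures through the Jordan decomposition. -/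

section SignedIntegral

variable {X : Type*} [MeasurableSpace X]

theorem integral_lsmul_toSignedMeasure (m : Measure X) [IsFiniteMeasure m] (f : X → ℝ) :
    ∫ᵛ x, f x ∂•m.toSignedMeasure = ∫ x, f x ∂m := by
  rw [← VectorMeasure.integral_toSignedMeasure]
  congr 1
  ext
  simp

theorem integral_lsmul_eq_sub (μ : SignedMeasure X) {f : X → ℝ}
    (hp : Integrable f μ.toJordanDecomposition.posPart)
    (hn : Integrable f μ.toJordanDecomposition.negPart) :
    ∫ᵛ x, f x ∂•μ = ∫ x, f x ∂μ.toJordanDecomposition.posPart -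
      ∫ x, f x ∂μ.toJordanDecomposition.negPart := by
  conv_lhs => rw [← μ.toSignedMeasure_toJordanDecomposition, JordanDecomposition.toSignedMeasure]
  rw [VectorMeasure.integral_sub_vectorMeasure (by simpa [VectorMeasure.Integrable] using hp)
    (by simpa [VectorMeasure.Integrable] using hn), integral_lsmul_toSignedMeasure,
    integral_lsmul_toSignedMeasure]

theorem univ_eq_sub (μ : SignedMeasure X) :
    μ univ = μ.toJordanDecomposition.posPart.real univ -
      μ.toJordanDecomposition.negPart.real univ := by
  conv_lhs => rw [← μ.toSignedMeasure_toJordanDecomposition, JordanDecomposition.toSignedMeasure]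
  simp

end SignedIntegral

/-! ### The canonical measure as a linear functional. -/

section Functional

theorem intervalIntegrable_pt {Γ : MetrizedGraph V E} {f : Γ.Point → ℝ} (hf : Continuous f)
    (e : E) (a b : ℝ) : IntervalIntegrable (fun t => f (Γ.pt e t)) volume a b :=
  (hf.comp (Γ.continuous_pt e)).intervalIntegrable a b

variable [Fintype V] [Fintype E] (Γ : MetrizedGraph V E)

/-- The coefficient `L / (L + R)` of an edge of length `L`, where `R` is the resistance between its
end points after the edge is removed. -/
noncomputable def foster (e : E) : ℝ := 1 - Γ.edgeRes e / Γ.length e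

/-- The integral against the canonical measure. -/
noncomputable def canonInt (f : Γ.Point → ℝ) : ℝ :=
  ∑ p, f (Point.vertex p) + ∑ e, (Γ.foster e / Γ.length e * (∫ t in 0..Γ.length e, f (Γ.pt e t)) -
    1 / 2 * f (Point.vertex (Γ.source e)) - 1 / 2 * f (Point.vertex (Γ.target e)))

variable {Γ} {f h : Γ.Point → ℝ}

theorem canonInt_add (hf : Continuous f) (hh : Continuous h) :
    Γ.canonInt (fun x => f x + h x) = Γ.canonInt f + Γ.canonInt h := by
  have (e : E) : ∫ t in 0..Γ.length e, (f (Γ.pt e t) + h (Γ.pt e t)) =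
      (∫ t in 0..Γ.length e, f (Γ.pt e t)) + ∫ t in 0..Γ.length e, h (Γ.pt e t) :=
    intervalIntegral.integral_add (intervalIntegrable_pt hf e _ _) (intervalIntegrable_pt hh e _ _)
  simp only [canonInt, this, Finset.sum_add_distrib]
  rw [add_add_add_comm, add_right_inj, ← Finset.sum_add_distrib]
  exact Finset.sum_congr rfl fun _ _ => by ring

theorem canonInt_const_mul (c : ℝ) (f : Γ.Point → ℝ) :
    Γ.canonInt (fun x => c * f x) = c * Γ.canonInt f := by
  simp only [canonInt, intervalIntegral.integral_const_mul, mul_add, Finset.mul_sum]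
  congr 1
  exact Finset.sum_congr rfl fun _ _ => by ring

variable (Γ)

theorem canonInt_lin (a : V → ℝ) : Γ.canonInt (Γ.lin a) = Γ.canonicalSum a := by
  have (e : E) : ∫ t in 0..Γ.length e, Γ.lin a (Γ.pt e t) =
      Γ.length e * (a (Γ.source e) + a (Γ.target e)) / 2 := by
    have hL := Γ.length_pos e
    rw [intervalIntegral.integral_congr (g := fun t => a (Γ.source e) +
        t * ((a (Γ.target e) - a (Γ.source e)) / Γ.length e)) fun t ht => ?_]
    · rw [intervalIntegral.integral_add (by simp) (Continuous.intervalIntegrable (by fun_prop) _ _),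
        intervalIntegral.integral_mul_const, integral_id]
      simp
      field_simp
      ring
    · rw [uIcc_of_le hL.le] at ht
      beta_reduce
      rw [lin_pt _ _ _ ht]
      ring
  simp only [canonInt, this, lin_vertex, canonicalSum, foster, Finset.mul_sum, sub_eq_add_neg,
    ← Finset.sum_neg_distrib]
  congr 1
  refine Finset.sum_congr rfl fun e _ => ?_
  have := (Γ.length_pos e).ne'
  field_simp
  ring

theorem canonInt_const (c : ℝ) : Γ.canonInt (fun _ => c) = c := by
  have h1 : Γ.lin (fun _ => 1) = fun _ => 1 := by
    ext x
    obtain ⟨p, q, a, b, -, -, hab, h⟩ := Γ.exists_lin_eq x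
    rw [h, mul_one, mul_one, hab]
  have h2 : Γ.canonInt (fun _ => 1) = 1 := by rw [← h1, canonInt_lin, canonicalSum_one]
  simpa [h2] using canonInt_const_mul (Γ := Γ) c fun _ => 1

theorem canonicalSum_lin (k : V → V → ℝ) (x : Γ.Point) :
    Γ.canonicalSum (fun q => Γ.lin (k q) x) =
      Γ.lin (fun p => Γ.canonicalSum fun q => k q p) x := by
  obtain ⟨p, q, a, b, -, -, -, h⟩ := Γ.exists_lin_eq x
  have (e : E) : Γ.edgeRes e / Γ.length e * (a * k (Γ.source e) p + b * k (Γ.source e) q +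
      (a * k (Γ.target e) p + b * k (Γ.target e) q)) =
      a * (Γ.edgeRes e / Γ.length e * (k (Γ.source e) p + k (Γ.target e) p)) +
      b * (Γ.edgeRes e / Γ.length e * (k (Γ.source e) q + k (Γ.target e) q)) := by ring
  simp only [h, canonicalSum, this, Finset.sum_add_distrib, ← Finset.mul_sum]
  ring

/-- The difference between `greenPt x x` and its interpolation from the vertices. -/
noncomputable def quad : Γ.Point → ℝ
  | Point.vertex _ => 0
  | Point.inner e t _ => Γ.foster e * (t * (Γ.length e - t) / Γ.length e)

theorem quad_inner (e : E) (t : ℝ) (ht : t ∈ Ioo 0 (Γ.length e)) :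
    Γ.quad (Point.inner e t ht) = Γ.foster e * (t * (Γ.length e - t) / Γ.length e) := rfl

theorem quad_vertex (p : V) : Γ.quad (Point.vertex p) = 0 := rfl

theorem quad_pt (e : E) {t : ℝ} (ht : t ∈ Icc 0 (Γ.length e)) :
    Γ.quad (Γ.pt e t) = Γ.foster e * (t * (Γ.length e - t) / Γ.length e) := by
  rcases ht.1.eq_or_lt with rfl | h
  · simp [pt_zero, quad_vertex]
  rcases ht.2.eq_or_lt with rfl | h'
  · simp [pt_length, quad_vertex]
  · rw [pt_of_mem _ (mem_Ioo.2 ⟨h, h'⟩), quad_inner]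

theorem continuous_quad : Continuous Γ.quad := by
  rw [continuous_iff]
  intro e
  refine ContinuousOn.congr ?_ fun t ht => Γ.quad_pt e ht
  fun_prop

/-- With λ = t/L, bilinear interpolation on the diagonal falls short of linear interpolation by
λ(1-λ)R_e, while the bubble adds λ(1-λ)L_e. -/
theorem greenPt_self (x : Γ.Point) :
    Γ.greenPt x x = Γ.lin (fun p => Γ.green p p) x + Γ.quad x := by
  cases x with
  | vertex p => simp [greenPt, quad_vertex]
  | inner e t ht =>
    rw [greenPt, bub_inner, quad_inner, min_self]
    simp only [lin_inner, foster, edgeRes, res]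
    rw [Γ.green_comm (Γ.target e) (Γ.source e)]
    have := (Γ.length_pos e).ne'
    field_simp
    ring

theorem canonInt_quad : Γ.canonInt Γ.quad = 1 / 6 * ∑ e, Γ.length e * Γ.foster e ^ 2 := by
  have (e : E) : ∫ t in 0..Γ.length e, Γ.quad (Γ.pt e t) =
      Γ.foster e * Γ.length e ^ 2 / 6 := by
    have hL := Γ.length_pos e
    rw [intervalIntegral.integral_congr (g := fun t => Γ.foster e * t -
        Γ.foster e / Γ.length e * t ^ 2) fun t ht => ?_]
    · rw [intervalIntegral.integral_sub (Continuous.intervalIntegrable (by fun_prop) _ _)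
        (Continuous.intervalIntegrable (by fun_prop) _ _), intervalIntegral.integral_const_mul,
        intervalIntegral.integral_const_mul, integral_id, integral_pow]
      simp
      field_simp
      ring
    · rw [uIcc_of_le hL.le] at ht
      beta_reduce
      rw [quad_pt _ _ ht]
      field_simp
  simp only [canonInt, this, quad_vertex, Finset.mul_sum]
  rw [Finset.sum_const_zero, zero_add]
  refine Finset.sum_congr rfl fun e _ => ?_
  have := (Γ.length_pos e).ne'
  field_simp
  ring

/-- The bubble lives on one edge, vanishes at the vertices and has area s(L-s)/2, so only the
density F_e/L_e contributes. -/
theorem canonInt_bub (x : Γ.Point) : 2 * Γ.canonInt (fun z => Γ.bub z x) = Γ.quad x := by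
  cases x with
  | vertex p =>
    simp only [bub_vertex_right, quad_vertex, canonInt_const, mul_zero]
  | inner e s hs =>
    have hL := Γ.length_pos e
    have h1 : ∫ t in 0..Γ.length e, Γ.bub (Γ.pt e t) (Point.inner e s hs) =
        s * (Γ.length e - s) / 2 := by
      have hc := Γ.continuous_bub (Point.inner e s hs)
      rw [← intervalIntegral.integral_add_adjacent_intervals
        (intervalIntegrable_pt hc e 0 s) (intervalIntegrable_pt hc e s _),
        intervalIntegral.integral_congr (a := 0) (b := s) (g := fun t => (1 - s / Γ.length e) * t)
          fun t ht => ?_,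
        intervalIntegral.integral_congr (a := s) (g := fun t => s - s / Γ.length e * t)
          fun t ht => ?_,
        intervalIntegral.integral_sub (by simp) (Continuous.intervalIntegrable (by fun_prop) _ _),
        intervalIntegral.integral_const_mul, intervalIntegral.integral_const_mul, integral_id,
        integral_id]
      · simp
        field_simp
        ring
      · rw [uIcc_of_le hs.2.le] at ht
        beta_reduce
        rw [bub_pt_inner _ _ _ ⟨hs.1.le.trans ht.1, ht.2⟩, min_eq_right ht.1]
        ring
      · rw [uIcc_of_le hs.1.le] at ht
        beta_reduce
        rw [bub_pt_inner _ _ _ ⟨ht.1, ht.2.trans hs.2.le⟩, min_eq_left ht.2]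
        ring
    simp only [canonInt, bub_vertex_left, Finset.sum_const_zero, mul_zero, sub_zero, zero_add]
    rw [Finset.sum_eq_single e, h1, quad_inner]
    · field_simp
    · intro e' _ he
      simp [bub_pt_inner_of_ne _ he]
    · simp

/-- The effective resistance between two points. -/
noncomputable def resPt (x z : Γ.Point) : ℝ :=
  Γ.greenPt x x - 2 * Γ.greenPt x z + Γ.greenPt z z

theorem resPt_comm (x z : Γ.Point) : Γ.resPt x z = Γ.resPt z x := by
  rw [resPt, resPt, Γ.greenPt_comm z x]
  ring

theorem continuous_greenPt_self : Continuous fun x => Γ.greenPt x x := by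
  simp only [greenPt_self]
  exact (Γ.continuous_lin _).add Γ.continuous_quad

theorem continuous_resPt_left (z : Γ.Point) : Continuous fun x => Γ.resPt x z :=
  (Γ.continuous_greenPt_self.sub (continuous_const.mul (Γ.continuous_greenPt z))).add
    continuous_const

theorem continuous_resPt_right (x : Γ.Point) : Continuous (Γ.resPt x) := by
  simpa only [resPt_comm] using Γ.continuous_resPt_left x

/-- The interpolated part balances by `green_self_sub`, the quadratic part by `canonInt_bub`. -/
theorem canonInt_greenPt (x : Γ.Point) :
    Γ.greenPt x x - 2 * Γ.canonInt (fun z => Γ.greenPt z x) = Γ.greenConst := by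
  have h1 : Γ.canonInt (fun z => Γ.greenPt z x) =
      Γ.lin (fun p => Γ.canonicalSum fun q => Γ.green q p) x +
        Γ.canonInt (fun z => Γ.bub z x) := by
    simp only [greenPt]
    rw [canonInt_add (Γ.continuous_lin _) (Γ.continuous_bub x), ← canonicalSum_lin, ← canonInt_lin]
  rw [h1, mul_add, canonInt_bub, greenPt_self]
  obtain ⟨p, q, a, b, -, -, hab, h⟩ := Γ.exists_lin_eq x
  rw [h, h]
  linear_combination a * Γ.green_self_sub p + b * Γ.green_self_sub q + Γ.greenConst * hab

/-- Twice the tau constant. -/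
noncomputable def twoTau : ℝ :=
  Γ.greenConst + Γ.canonicalSum (fun p => Γ.green p p) +
    1 / 6 * ∑ e, Γ.length e * Γ.foster e ^ 2

theorem canonInt_resPt (x : Γ.Point) : Γ.canonInt (fun z => Γ.resPt z x) = Γ.twoTau := by
  have h1 : (fun z => Γ.resPt z x) = fun z => (Γ.lin (fun p => Γ.green p p) z + Γ.quad z) +
      ((-2) * Γ.greenPt z x + Γ.greenPt x x) := by
    ext z
    rw [resPt, Γ.greenPt_self z]
    ring
  have hc : Continuous fun z => (-2) * Γ.greenPt z x :=
    continuous_const.mul (Γ.continuous_greenPt x)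
  have hl : Continuous fun z => Γ.lin (fun p => Γ.green p p) z + Γ.quad z :=
    (Γ.continuous_lin _).add Γ.continuous_quad
  have hr : Continuous fun z => (-2) * Γ.greenPt z x + Γ.greenPt x x := hc.add continuous_const
  rw [h1, canonInt_add hl hr, canonInt_add (Γ.continuous_lin _) Γ.continuous_quad,
    canonInt_add hc continuous_const, canonInt_const, canonInt_const_mul, canonInt_lin,
    canonInt_quad, twoTau, ← Γ.canonInt_greenPt x]
  ring

/-- The uniform bound serves integrability, Fubini and dominated convergence. -/
theorem exists_abs_resPt_le : ∃ M, ∀ x z, |Γ.resPt x z| ≤ M := by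
  have hlin : ∀ (f : V → ℝ) (B : ℝ), (∀ p, |f p| ≤ B) → ∀ x, |Γ.lin f x| ≤ B := by
    intro f B hB x
    obtain ⟨p, q, a, b, ha, hb, hab, h⟩ := Γ.exists_lin_eq x
    rw [h]
    calc |a * f p + b * f q| ≤ |a * f p| + |b * f q| := abs_add_le _ _
      _ = a * |f p| + b * |f q| := by rw [abs_mul, abs_mul, abs_of_nonneg ha, abs_of_nonneg hb]
      _ ≤ a * B + b * B := by
        gcongr
        · exact hB p
        · exact hB q
      _ = B := by rw [← add_mul, hab, one_mul]
  have hbub : ∀ x y, |Γ.bub x y| ≤ ∑ e, Γ.length e := by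
    intro x y
    have h0 : 0 ≤ ∑ e, Γ.length e := Finset.sum_nonneg fun e _ => (Γ.length_pos e).le
    cases x with
    | vertex p => simpa using h0
    | inner e s hs =>
      cases y with
      | vertex q => simpa using h0
      | inner e' t ht =>
        rcases eq_or_ne e e' with rfl | he
        · have hL := Γ.length_pos e
          rw [bub_inner]
          refine le_trans ?_ (Finset.single_le_sum (fun e _ => (Γ.length_pos e).le)
            (Finset.mem_univ e))
          have h1 : s * t / Γ.length e ≤ min s t := by
            rw [div_le_iff₀ hL]
            rcases min_cases s t with ⟨h, -⟩ | ⟨h, -⟩ <;> rw [h]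
            · exact mul_le_mul_of_nonneg_left ht.2.le hs.1.le
            · rw [mul_comm]
              exact mul_le_mul_of_nonneg_left hs.2.le ht.1.le
          have h2 : 0 ≤ s * t / Γ.length e := div_nonneg (mul_nonneg hs.1.le ht.1.le) hL.le
          rw [abs_of_nonneg (sub_nonneg.2 h1)]
          linarith [min_le_left s t, hs.2]
        · simpa [bub, he] using h0
  set B := ∑ p, ∑ q, |Γ.green p q|
  have hB : ∀ p q, |Γ.green p q| ≤ B := fun p q =>
    (Finset.single_le_sum (f := fun q => |Γ.green p q|) (fun _ _ => abs_nonneg _)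
      (Finset.mem_univ q)).trans (Finset.single_le_sum (f := fun p => ∑ q, |Γ.green p q|)
        (fun _ _ => Finset.sum_nonneg fun _ _ => abs_nonneg _) (Finset.mem_univ p))
  have hg : ∀ x y, |Γ.greenPt x y| ≤ B + ∑ e, Γ.length e := fun x y =>
    (abs_add_le _ _).trans (add_le_add
      (hlin _ _ (fun p => hlin _ _ (fun q => hB p q) y) x) (hbub x y))
  refine ⟨4 * (B + ∑ e, Γ.length e), fun x z => ?_⟩
  have h1 := abs_le.1 (hg x x)
  have h2 := abs_le.1 (hg x z)
  have h3 := abs_le.1 (hg z z)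
  rw [resPt, abs_le]
  constructor <;> linarith [h1.1, h1.2, h2.1, h2.2, h3.1, h3.2]

end Functional

/-! ### Lebesgue measure on the edges. -/

section Measures

variable (Γ : MetrizedGraph V E)

theorem integrable_of_continuous_of_le {Γ : MetrizedGraph V E} {f : Γ.Point → ℝ}
    (hf : Continuous f) {M : ℝ} (hM : ∀ x, |f x| ≤ M) (m : Measure Γ.Point) [IsFiniteMeasure m] :
    Integrable f m :=
  Integrable.of_bound hf.aestronglyMeasurable M (Filter.Eventually.of_forall hM)

/-- Lebesgue measure on an edge, as a measure on the graph. -/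
noncomputable def edgeMeasure (e : E) : Measure Γ.Point :=
  (volume.restrict (Ioc 0 (Γ.length e))).map (Γ.pt e)

instance (e : E) : IsFiniteMeasure (Γ.edgeMeasure e) := by
  unfold edgeMeasure
  infer_instance

theorem integral_edgeMeasure {f : Γ.Point → ℝ} (hf : Continuous f) (e : E) :
    ∫ x, f x ∂Γ.edgeMeasure e = ∫ t in 0..Γ.length e, f (Γ.pt e t) := by
  rw [edgeMeasure, integral_map (Γ.continuous_pt e).aemeasurable hf.aestronglyMeasurable,
    intervalIntegral.integral_of_le (Γ.length_pos e).le]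

theorem integrable_edgeMeasure {f : Γ.Point → ℝ} (hf : Continuous f) (e : E) :
    Integrable f (Γ.edgeMeasure e) := by
  rw [edgeMeasure, integrable_map_measure hf.aestronglyMeasurable
    (Γ.continuous_pt e).aemeasurable]
  exact (intervalIntegrable_iff_integrableOn_Ioc_of_le (Γ.length_pos e).le).1
    (intervalIntegrable_pt hf e 0 (Γ.length e))

end Measures

/-! ### The canonical measure and the value of tau. -/

section Canonical

variable [Fintype V] [Fintype E] (Γ : MetrizedGraph V E)

/-- An explicit canonical measure. -/
noncomputable def canonicalSigned : SignedMeasure Γ.Point :=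
  ∑ p, VectorMeasure.dirac (Point.vertex p) 1 +
    ∑ e, ((Γ.foster e / Γ.length e) • (Γ.edgeMeasure e).toSignedMeasure -
      (1 / 2 : ℝ) • VectorMeasure.dirac (Point.vertex (Γ.source e)) 1 -
      (1 / 2 : ℝ) • VectorMeasure.dirac (Point.vertex (Γ.target e)) 1)

theorem integral_canonicalSigned {f : Γ.Point → ℝ} (hf : Continuous f) :
    ∫ᵛ x, f x ∂•Γ.canonicalSigned = Γ.canonInt f := by
  have hd (p : V) : (VectorMeasure.dirac (Point.vertex p : Γ.Point) (1 : ℝ)).Integrable f := by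
    rw [VectorMeasure.Integrable, VectorMeasure.variation_dirac]
    simpa using (integrable_dirac' hf.stronglyMeasurable (by finiteness))
  have he (e : E) : (Γ.edgeMeasure e).toSignedMeasure.Integrable f := by
    simpa [VectorMeasure.Integrable] using Γ.integrable_edgeMeasure hf e
  have hs (p : V) := (hd p).smul_vectorMeasure (1 / 2)
  have hse (e : E) := (he e).smul_vectorMeasure (Γ.foster e / Γ.length e)
  have hdi (p : V) : ∫ᵛ x, f x ∂•VectorMeasure.dirac (Point.vertex p : Γ.Point) (1 : ℝ) =
      f (Point.vertex p) := by
    rw [VectorMeasure.integral_dirac' hf.stronglyMeasurable]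
    simp
  rw [canonicalSigned, VectorMeasure.integral_add_vectorMeasure
    (VectorMeasure.Integrable.finsetSum_vectorMeasure fun p _ => hd p)
    (VectorMeasure.Integrable.finsetSum_vectorMeasure fun e _ =>
      ((hse e).sub_vectorMeasure (hs _)).sub_vectorMeasure (hs _)),
    VectorMeasure.integral_finsetSum_vectorMeasure fun p _ => hd p,
    VectorMeasure.integral_finsetSum_vectorMeasure fun e _ =>
      ((hse e).sub_vectorMeasure (hs _)).sub_vectorMeasure (hs _), canonInt]
  simp only [hdi]
  congr 1
  refine Finset.sum_congr rfl fun e _ => ?_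
  rw [VectorMeasure.integral_sub_vectorMeasure ((hse e).sub_vectorMeasure (hs _)) (hs _),
    VectorMeasure.integral_sub_vectorMeasure (hse e) (hs _),
    VectorMeasure.integral_smul_vectorMeasure, VectorMeasure.integral_smul_vectorMeasure,
    VectorMeasure.integral_smul_vectorMeasure, hdi, hdi, integral_lsmul_toSignedMeasure,
    Γ.integral_edgeMeasure hf]
  simp only [smul_eq_mul]

theorem measureVoltage_self (μ : SignedMeasure Γ.Point) (x : Γ.Point) :
    Γ.measureVoltage μ x x = ∫ᵛ z, Γ.resPt x z ∂•μ := by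
  simp only [measureVoltage, voltage_self, resPt]

theorem measureVoltage_canonicalSigned (x : Γ.Point) :
    Γ.measureVoltage Γ.canonicalSigned x x = Γ.twoTau := by
  rw [measureVoltage_self, integral_canonicalSigned _ (Γ.continuous_resPt_right x),
    ← Γ.canonInt_resPt x]
  simp only [resPt_comm]

theorem canonicalSigned_univ : Γ.canonicalSigned univ = 1 := by
  have h := Γ.integral_canonicalSigned (f := fun _ => 1) continuous_const
  rw [canonInt_const] at h
  rw [← h, integral_lsmul_eq_sub _ (integrable_const _) (integrable_const _), univ_eq_sub]
  simp

theorem isCanonicalMeasure_canonicalSigned : Γ.IsCanonicalMeasure Γ.canonicalSigned :=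
  ⟨Γ.canonicalSigned_univ, fun x y => by
    rw [measureVoltage_canonicalSigned, measureVoltage_canonicalSigned]⟩

theorem canonInt_integral (m : Measure Γ.Point) [IsFiniteMeasure m] {r : Γ.Point → Γ.Point → ℝ}
    (hl : ∀ z, Continuous fun x => r x z) (hr : ∀ x, Continuous (r x)) {M : ℝ}
    (hM : ∀ x z, |r x z| ≤ M) :
    Γ.canonInt (fun x => ∫ z, r x z ∂m) = ∫ z, Γ.canonInt (fun x => r x z) ∂m := by
  have hi (x : Γ.Point) : Integrable (r x) m := integrable_of_continuous_of_le (hr x) (hM x) m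
  have hprod (e : E) : Integrable (Function.uncurry fun (t : ℝ) z => r (Γ.pt e t) z)
      ((volume.restrict (uIoc 0 (Γ.length e))).prod m) := by
    rw [uIoc_of_le (Γ.length_pos e).le]
    -- Continuity in the real parameter t and measurability in z give joint measurability.
    exact Integrable.of_bound (measurable_uncurry_of_continuous_of_measurable
      (fun z => (hl z).comp (Γ.continuous_pt e))
      (fun t => (hr _).measurable)).aestronglyMeasurable M
      (Filter.Eventually.of_forall fun p => hM _ _)
  have hint (e : E) : Integrable (fun z => ∫ t in 0..Γ.length e, r (Γ.pt e t) z) m := by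
    have := (hprod e).integral_prod_right
    simpa only [Function.uncurry, uIoc_of_le (Γ.length_pos e).le,
      intervalIntegral.integral_of_le (Γ.length_pos e).le] using this
  have hedge (e : E) : Integrable (fun z => Γ.foster e / Γ.length e *
      (∫ t in 0..Γ.length e, r (Γ.pt e t) z) - 1 / 2 * r (Point.vertex (Γ.source e)) z) m :=
    ((hint e).const_mul _).sub ((hi _).const_mul _)
  have hfull (e : E) : Integrable (fun z => Γ.foster e / Γ.length e *
      (∫ t in 0..Γ.length e, r (Γ.pt e t) z) - 1 / 2 * r (Point.vertex (Γ.source e)) z -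
        1 / 2 * r (Point.vertex (Γ.target e)) z) m :=
    (hedge e).sub ((hi _).const_mul _)
  simp only [canonInt]
  rw [integral_add (integrable_finsetSum _ fun p _ => hi _)
    (integrable_finsetSum _ fun e _ => hfull e),
    integral_finsetSum _ fun p _ => hi _,
    integral_finsetSum _ fun e _ => hfull e]
  congr 1
  refine Finset.sum_congr rfl fun e _ => ?_
  rw [integral_sub (hedge e) ((hi _).const_mul _),
    integral_sub ((hint e).const_mul _) ((hi _).const_mul _), integral_const_mul,
    integral_const_mul, integral_const_mul, intervalIntegral_integral_swap (hprod e)]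

/-- Apply `canonInt` to the constant function x ↦ j_μ(x,x): the result is that constant, and by
Fubini also μ(Γ) times `twoTau`. -/
theorem IsCanonicalMeasure.measureVoltage_eq {Γ : MetrizedGraph V E} {μ : SignedMeasure Γ.Point}
    (hμ : Γ.IsCanonicalMeasure μ) (x : Γ.Point) : Γ.measureVoltage μ x x = Γ.twoTau := by
  obtain ⟨M, hM⟩ := Γ.exists_abs_resPt_le
  set P := μ.toJordanDecomposition.posPart
  set N := μ.toJordanDecomposition.negPart
  have hi (m : Measure Γ.Point) [IsFiniteMeasure m] (x : Γ.Point) : Integrable (Γ.resPt x) m :=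
    integrable_of_continuous_of_le (Γ.continuous_resPt_right x) (hM x) m
  have hc (m : Measure Γ.Point) [IsFiniteMeasure m] : Continuous fun x => ∫ z, Γ.resPt x z ∂m := by
    -- Continuity is tested along edges, where dominated convergence has a real parameter.
    rw [continuous_iff]
    intro e
    refine Continuous.continuousOn ?_
    exact continuous_of_dominated (F := fun t z => Γ.resPt (Γ.pt e t) z) (bound := fun _ => M)
      (fun t => (hi m _).aestronglyMeasurable)
      (fun t => Filter.Eventually.of_forall fun z => hM _ z) (integrable_const _)
      (Filter.Eventually.of_forall fun z =>
        (Γ.continuous_resPt_left z).comp (Γ.continuous_pt e))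
  have hv (x : Γ.Point) : Γ.measureVoltage μ x x =
      ∫ z, Γ.resPt x z ∂P - ∫ z, Γ.resPt x z ∂N := by
    rw [measureVoltage_self, integral_lsmul_eq_sub _ (hi _ x) (hi _ x)]
  have hcanon (m : Measure Γ.Point) [IsFiniteMeasure m] :
      Γ.canonInt (fun x => ∫ z, Γ.resPt x z ∂m) = m.real univ * Γ.twoTau := by
    rw [Γ.canonInt_integral m Γ.continuous_resPt_left Γ.continuous_resPt_right hM]
    simp [canonInt_resPt]
  have hN : Continuous fun x => (-1) * ∫ z, Γ.resPt x z ∂N := continuous_const.mul (hc N)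
  calc Γ.measureVoltage μ x x = Γ.canonInt fun _ => Γ.measureVoltage μ x x :=
        (Γ.canonInt_const _).symm
    _ = Γ.canonInt fun y => ∫ z, Γ.resPt y z ∂P + (-1) * ∫ z, Γ.resPt y z ∂N := by
        congr 1
        ext y
        rw [hμ.2 x y, hv]
        ring
    _ = μ univ * Γ.twoTau := by
        rw [canonInt_add (hc P) hN, canonInt_const_mul, hcanon, hcanon,
          univ_eq_sub]
        ring
    _ = Γ.twoTau := by rw [hμ.1, one_mul]

theorem tau_eq : Γ.tau = 1 / 2 * Γ.twoTau := by
  have h : Γ.IsCanonicalMeasure Γ.canonicalMeasure :=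
    Classical.epsilon_spec ⟨_, Γ.isCanonicalMeasure_canonicalSigned⟩
  rw [tau, h.measureVoltage_eq]

end Canonical

/-! ### Lower bounds for tau. -/

section Bounds

variable [Fintype V] [Fintype E] (Γ : MetrizedGraph V E)

theorem tau_eq_energy (y : V) : Γ.tau =
    1 / 12 * ∑ e, Γ.length e * Γ.foster e ^ 2 +
      1 / 4 * Γ.energy (fun p => Γ.res p y) (fun p => Γ.res p y) := by
  rw [tau_eq, twoTau, energy_res]
  ring

theorem sum_foster : ∑ e, Γ.foster e = (Γ.genus : ℝ) := by
  simp only [foster, Finset.sum_sub_distrib, sum_edgeRes_div_length, genus]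
  simp
  ring

theorem res_self (p : V) : Γ.res p p = 0 := by
  rw [res]
  ring

theorem res_comm (p q : V) : Γ.res p q = Γ.res q p := by
  rw [res, res, Γ.green_comm q p]
  ring

/-- For each edge keep only the two y at its ends; each contributes R_e². -/
theorem sum_energy_res_ge :
    2 * ∑ e, Γ.edgeRes e ^ 2 / Γ.length e ≤
      ∑ y, Γ.energy (fun p => Γ.res p y) (fun p => Γ.res p y) := by
  classical
  simp only [energy]
  rw [Finset.sum_comm, Finset.mul_sum]
  refine Finset.sum_le_sum fun e _ => ?_
  have hL := Γ.length_pos e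
  rw [← Finset.sum_div, ← mul_div_assoc]
  refine div_le_div_of_nonneg_right ?_ hL.le
  -- A self-loop has only one end vertex, but then R_e = 0.
  rcases eq_or_ne (Γ.source e) (Γ.target e) with h | h
  · rw [edgeRes, h, res_self]
    simp
  · calc _ = ∑ y ∈ {Γ.source e, Γ.target e},
          (Γ.res (Γ.source e) y - Γ.res (Γ.target e) y) *
            (Γ.res (Γ.source e) y - Γ.res (Γ.target e) y) := by
          rw [Finset.sum_pair h, res_self, res_self, Γ.res_comm (Γ.target e) (Γ.source e), edgeRes]
          ring
      _ ≤ _ := Finset.sum_le_sum_of_subset_of_nonneg (Finset.subset_univ _)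
          fun _ _ _ => mul_self_nonneg _

/-- Average `tau_eq_energy` over all vertices y. -/
theorem tau_ge_add : 1 / 12 * ∑ e, Γ.length e * Γ.foster e ^ 2 +
    1 / (2 * Fintype.card V) * ∑ e, Γ.edgeRes e ^ 2 / Γ.length e ≤ Γ.tau := by
  have := Γ.connected.nonempty
  have hV : (0 : ℝ) < Fintype.card V := by exact_mod_cast Fintype.card_pos
  have h1 : ∑ _y : V, Γ.tau = _ := Finset.sum_congr rfl fun y _ => Γ.tau_eq_energy y
  rw [Finset.sum_add_distrib, ← Finset.mul_sum, Finset.sum_const, Finset.sum_const,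
    Finset.card_univ, ← Finset.mul_sum, nsmul_eq_mul, nsmul_eq_mul] at h1
  have h2 := Γ.sum_energy_res_ge
  refine le_of_mul_le_mul_left ?_ hV
  rw [h1, mul_add]
  have h3 : (Fintype.card V : ℝ) * (1 / (2 * Fintype.card V) *
      ∑ e, Γ.edgeRes e ^ 2 / Γ.length e) = 1 / 4 * (2 * ∑ e, Γ.edgeRes e ^ 2 / Γ.length e) := by
    field_simp
    ring
  rw [h3]
  linarith

/-- The lower bound for the tau constant of a graph whose edges have equal lengths. -/
theorem tau_ge_of_length_eq [Nonempty E] {L : ℝ} (hL : ∀ e, Γ.length e = L) :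
    Γ.totalLength * (1 / 12 * ((Γ.genus : ℝ) / Fintype.card E) ^ 2 +
      1 / (2 * Fintype.card V) * (((Fintype.card V : ℝ) - 1) / Fintype.card E) ^ 2) ≤ Γ.tau := by
  refine le_trans ?_ Γ.tau_ge_add
  have hL0 : 0 < L := hL (Classical.arbitrary E) ▸ Γ.length_pos _
  have hE : (0 : ℝ) < Fintype.card E := by exact_mod_cast Fintype.card_pos
  -- Cauchy-Schwarz with total length e·L; used for F_e, whose sum is g, and for R_e/L_e, whose sum
  -- is v - 1.
  have key (f : E → ℝ) : Γ.totalLength * ((∑ e, f e) / Fintype.card E) ^ 2 ≤ ∑ e, L * f e ^ 2 := by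
    have h := sq_sum_le_card_mul_sum_sq (s := Finset.univ) (f := f)
    have ht : Γ.totalLength = Fintype.card E * L := by simp [totalLength, hL]
    rw [ht, ← Finset.mul_sum, div_pow]
    rw [Finset.card_univ] at h
    calc _ = L * ((∑ e, f e) ^ 2 / Fintype.card E) := by field_simp
      _ ≤ _ := mul_le_mul_of_nonneg_left ((div_le_iff₀' hE).2 h) hL0.le
  have h1 := key Γ.foster
  have h2 := key fun e => Γ.edgeRes e / Γ.length e
  rw [sum_foster] at h1
  rw [sum_edgeRes_div_length] at h2
  simp only [hL] at h2 ⊢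
  have h3 (e : E) : L * (Γ.edgeRes e / L) ^ 2 = Γ.edgeRes e ^ 2 / L := by field_simp
  simp only [h3] at h2
  rw [mul_add, mul_left_comm, mul_left_comm Γ.totalLength (1 / (2 * (Fintype.card V : ℝ)))]
  gcongr

theorem sum_valence : ∑ p, Γ.valence p = 2 * Fintype.card E := by
  classical
  have h (s : E → V) : ∑ p, (Finset.univ.filter fun e => s e = p).card = Fintype.card E := by
    rw [← Finset.card_univ, Finset.card_eq_sum_card_fiberwise (f := s) (t := Finset.univ)]
    simp
  have h1 := h Γ.source
  have h2 := h Γ.target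
  simp only [valence, Finset.sum_add_distrib, two_mul]
  exact congrArg₂ (· + ·) h1 h2

end Bounds

end MetrizedGraph

theorem mainTheorem6 {V E : Type*} [Fintype V] [Fintype E] (Γ : MetrizedGraph V E)
    (hequal : ∀ e₁ e₂ : E, Γ.length e₁ = Γ.length e₂) :
    (Γ.totalLength = 1 →
      1 / 12 * ((Γ.genus : ℝ) / Fintype.card E) ^ 2 ≤ Γ.tau ∧
      1 / 12 * ((Γ.genus : ℝ) / Fintype.card E) ^ 2 +
        1 / (2 * Fintype.card V) * (((Fintype.card V : ℝ) - 1) / Fintype.card E) ^ 2 ≤ Γ.tau) ∧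
    ((∀ p : V, 3 ≤ Γ.valence p) → 1 / 108 * Γ.totalLength ≤ Γ.tau) := by
  have hextra : 0 ≤ 1 / (2 * (Fintype.card V : ℝ)) *
      (((Fintype.card V : ℝ) - 1) / Fintype.card E) ^ 2 := by positivity
  constructor
  · intro h1
    have : Nonempty E := by
      by_contra hE
      rw [not_nonempty_iff] at hE
      simp [MetrizedGraph.totalLength] at h1
    have h := Γ.tau_ge_of_length_eq fun e => hequal e (Classical.arbitrary E)
    rw [h1, one_mul] at h
    exact ⟨by linarith, h⟩
  · intro hval
    have hV := Γ.connected.nonempty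
    have hsum : 3 * Fintype.card V ≤ 2 * Fintype.card E := by
      rw [← Γ.sum_valence, mul_comm, ← smul_eq_mul, ← Finset.card_univ]
      exact Finset.card_nsmul_le_sum _ _ _ fun p _ => hval p
    have hVpos : 0 < Fintype.card V := Fintype.card_pos
    have : Nonempty E := Fintype.card_pos_iff.1 (by omega)
    have hE : (0 : ℝ) < Fintype.card E := by exact_mod_cast Fintype.card_pos
    refine le_trans ?_ (Γ.tau_ge_of_length_eq fun e => hequal e (Classical.arbitrary E))
    -- From 3v ≤ 2e: g = e - v + 1 > e - 2e/3 = e/3.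
    have hg : (1 / 3 : ℝ) ≤ (Γ.genus : ℝ) / Fintype.card E := by
      rw [le_div_iff₀ hE, MetrizedGraph.genus]
      have : (3 * Fintype.card V : ℝ) ≤ 2 * Fintype.card E := by exact_mod_cast hsum
      push_cast
      linarith
    have hg2 : (1 / 3 : ℝ) ^ 2 ≤ ((Γ.genus : ℝ) / Fintype.card E) ^ 2 :=
      pow_le_pow_left₀ (by norm_num) hg 2
    have ht : 0 ≤ Γ.totalLength := Finset.sum_nonneg fun e _ => (Γ.length_pos e).le
    rw [mul_comm]
    -- Here 1/108 = 1/12 · (1/3)², and the second term of the bound is dropped by `hextra`.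
    exact mul_le_mul_of_nonneg_left (by linarith) ht
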